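/- Let $K_0,\tau_1,\tau_2>0$. For $\omega\in\mathbb R$ consider the PLL model with sinusoidal phase detector characteristic and active PI filter, $$\dot x=\sin\theta,\qquad \dot\theta=\omega-\frac{K_0}{\tau_1}\bigl(x+\tau_2\sin\theta\bigr),\qquad (\theta,x)\in\mathbb R^2,\tag{$\ast_\omega$}$$ where $\omega$ is the free frequency deviation $\omega_\Delta^{\rm free}$, and put $x_{eq}(\omega)=\omega\tau_1/K_0$, $\theta^s_{eq}=0$. (The equilibria with $\theta\in(-\pi,\pi]$ are the stable one, $(\theta^s_{eq},x_{eq}(\omega))$, and the saddle, $(\pi,x_{eq}(\omega))$.) Definitions. Solutions start at $t=0$ and are considered for $t\ge 0$ unless another time set is named. A locked state of $(\ast_\omega)$ is a locally asymptotically stable equilibrium. The model $(\ast_\omega)$ is called globally asymptotically stable if each of its solutions tends to an equilibrium as $t\to+\infty$. A solution slips cycles if $\limsup_{t\to+\infty}|\theta(0)-\theta(t)|\ge 2\pi$. The lock-in domain $D(\omega)$ is the set of initial states whose solution of $(\ast_\omega)$ tends to a locked state and does not slip cycles. The lock-in frequency $\omega_l$ is the largest number $w>0$ such that, for all $\omega$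 with $|\omega|<w$, $(\ast_\omega)$ is globally asymptotically stable and $(\theta^s_{eq},x_{eq}(\omega))\in\bigcap_{|\omega'|<w}D(\omega')$; the interval $[0,\omega_l)$ is the lock-in range. The lower separatrix of the saddle $(\pi,x_{eq}(\omega))$ is the set of initial states whose solution of $(\ast_\omega)$ tends to $(\pi,x_{eq}(\omega))$ as $t\to+\infty$ with $x(t)<x_{eq}(\omega)$ for all large $t$. Then: 1. The parameter $\omega$ only shifts the phase plane vertically: on any set of times, $(\theta(t),x(t))$ is a solution of $(\ast_\omega)$ if and only if $(\theta(t),\,x(t)-\omega\tau_1/K_0)$ is a solution of $(\ast_0)$. 2. For every $\omega$ the part of the lower separatrix over $-\pi<\theta<\pi$ is the graph $x=Q(\theta,\omega)$ of a function, and $Q(\theta,\omega)=\omega\tau_1/K_0+Q(\theta,0)$ for $-\pi<\theta<\pi$. 3. A real number $\omega_l$ is the lock-in frequency if and only if $x_{eq}(-\omega_l)=Q(\theta^s_{eq},\omega_l)$. 4. The lock-in frequency exists and is given by the exact formula $$\omega_l=-\frac{K_0\,Q(\theta^s_{eq},0)}{2\tau_1}=-\frac{K_0\,Q(0,0)}{2\tau_1}.$$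 -/

import Mathlib

open Set Filter Topology

namespace PLL

/-- The vector field, on the phase plane with coordinates `(θ, x)` (phase error, filter state), of
the PLL model with sinusoidal phase detector characteristic and active PI filter:
`θ' = ω - (K₀ / τ₁) (x + τ₂ sin θ)`, `x' = sin θ`. Here `ω` is the free frequency deviation. -/
noncomputable def field (K₀ τ₁ τ₂ ω : ℝ) (p : ℝ × ℝ) : ℝ × ℝ :=
  (ω - K₀ / τ₁ * (p.2 + τ₂ * Real.sin p.1), Real.sin p.1)

/-- `γ` solves the model with free frequency deviation `ω` on the time set `s`. -/
def IsSolutionOn (K₀ τ₁ τ₂ ω : ℝ) (γ : ℝ → ℝ × ℝ) (s : Set ℝ) : Prop :=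
  IsIntegralCurveOn γ (fun _ => field K₀ τ₁ τ₂ ω) s

/-- Equilibria of the model. -/
def IsEquilibrium (K₀ τ₁ τ₂ ω : ℝ) (p : ℝ × ℝ) : Prop :=
  field K₀ τ₁ τ₂ ω p = 0

/-- The filter state `x_eq(ω)` of the equilibria. -/
noncomputable def xEq (K₀ τ₁ ω : ℝ) : ℝ := ω * τ₁ / K₀

/-- Locked states: the locally asymptotically stable equilibria. -/
def IsLockedState (K₀ τ₁ τ₂ ω : ℝ) (p : ℝ × ℝ) : Prop :=
  IsEquilibrium K₀ τ₁ τ₂ ω p ∧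
  (∀ U ∈ 𝓝 p, ∃ V ∈ 𝓝 p, ∀ γ : ℝ → ℝ × ℝ, IsSolutionOn K₀ τ₁ τ₂ ω γ (Ici 0) →
    γ 0 ∈ V → ∀ t, 0 ≤ t → γ t ∈ U) ∧
  (∃ V ∈ 𝓝 p, ∀ γ : ℝ → ℝ × ℝ, IsSolutionOn K₀ τ₁ τ₂ ω γ (Ici 0) →
    γ 0 ∈ V → Tendsto γ atTop (𝓝 p))

/-- Global asymptotic stability: every solution tends to an equilibrium. -/
def IsGloballyAsymptoticallyStable (K₀ τ₁ τ₂ ω : ℝ) : Prop :=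
  ∀ γ : ℝ → ℝ × ℝ, IsSolutionOn K₀ τ₁ τ₂ ω γ (Ici 0) →
    ∃ p, IsEquilibrium K₀ τ₁ τ₂ ω p ∧ Tendsto γ atTop (𝓝 p)

/-- Cycle slipping: `limsup |θ(0) - θ(t)| ≥ 2π` as `t → +∞` (computed in the extended reals). -/
def CycleSlips (γ : ℝ → ℝ × ℝ) : Prop :=
  ((2 * Real.pi : ℝ) : EReal) ≤ limsup (fun t => ((|(γ 0).1 - (γ t).1| : ℝ) : EReal)) atTop

/-- The lock-in domain for a fixed frequency deviation: the states from which the model reaches a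
locked state without cycle slipping. -/
def lockInDomain (K₀ τ₁ τ₂ ω : ℝ) : Set (ℝ × ℝ) :=
  {p | ∃ γ : ℝ → ℝ × ℝ, IsSolutionOn K₀ τ₁ τ₂ ω γ (Ici 0) ∧ γ 0 = p ∧
    (∃ q, IsLockedState K₀ τ₁ τ₂ ω q ∧ Tendsto γ atTop (𝓝 q)) ∧ ¬ CycleSlips γ}

/-- The requirement on the interval `[0, w)` in the definition of the lock-in range. -/
def HasLockInProperty (K₀ τ₁ τ₂ w : ℝ) : Prop :=
  (∀ ω : ℝ, |ω| < w → IsGloballyAsymptoticallyStable K₀ τ₁ τ₂ ω) ∧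
  ∀ ω : ℝ, |ω| < w → (0, xEq K₀ τ₁ ω) ∈ ⋂ ω' ∈ {ω' : ℝ | |ω'| < w}, lockInDomain K₀ τ₁ τ₂ ω'

/-- `w` is the lock-in frequency: `[0, w)` is the largest interval with the lock-in property. -/
def IsLockInFrequency (K₀ τ₁ τ₂ w : ℝ) : Prop :=
  IsGreatest {v : ℝ | 0 < v ∧ HasLockInProperty K₀ τ₁ τ₂ v} w

/-- The lower separatrix of the saddle `(π, x_eq(ω))`, as a subset of the phase plane: the states
whose solution tends to the saddle as `t → +∞`, approaching it through `x < x_eq(ω)`. -/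
def lowerSeparatrix (K₀ τ₁ τ₂ ω : ℝ) : Set (ℝ × ℝ) :=
  {p | ∃ γ : ℝ → ℝ × ℝ, IsSolutionOn K₀ τ₁ τ₂ ω γ (Ici 0) ∧ γ 0 = p ∧
    Tendsto γ atTop (𝓝 (Real.pi, xEq K₀ τ₁ ω)) ∧ ∀ᶠ t in atTop, (γ t).2 < xEq K₀ τ₁ ω}

/-- The lower separatrix as a function `Q(θ, ω)`: the ordinate of its point above `θ`. -/
noncomputable def Q (K₀ τ₁ τ₂ θ ω : ℝ) : ℝ :=
  Classical.epsilon fun x : ℝ => (θ, x) ∈ lowerSeparatrix K₀ τ₁ τ₂ ω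

end PLL

namespace PLL

/-! Subtracting `xEq` from `x` reduces every ω to ω = 0, so a single phase portrait decides
everything. With a = K₀/τ₁ and b = τ₂, the energy a x²/2 + 1 - cos θ decays at rate a b sin² θ, and
Barbalat's lemma sends every orbit to some (kπ, 0). Global stability therefore holds for all ω and
never limits the lock-in range.

The saddles have energy 2. Start with x < 0 over (-π, π). Either the orbit passes θ = π, and then
its limit is at least 2π (`one_lt_of_tendsto`); or it falls below energy 2 left of π and tends to θ
= 0 (`tendsto_zero_of_neg`); or it converges to the saddle (`isSeparatrixOrbit`). The first two
cases are open, disjoint and nonempty, so connectedness of the half-line x < 0 forces the third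
(`exists_separatrix`). It occurs only once above each θ, because two separatrix orbits, compared
through x² as a function of θ, cannot draw together at the saddle (`snd_unique`).

So Q separates capture from cycle slipping. Seen from ω', the locked state of ω has height (ω -
ω')τ₁/K₀ over θ = 0. For |ω|, |ω'| < w these heights fill an open interval of half-length 2wτ₁/K₀,
and the lock-in property becomes 2wτ₁/K₀ ≤ -Q(0, 0), a closed condition on w whose maximum is
attained. -/

/-- A curve `(θ, x)`, defined for all times, solving the model with `ω = 0`, `a = K₀ / τ₁` and
`b = τ₂`. -/
structure IsOrbit (a b : ℝ) (θ x : ℝ → ℝ) : Prop where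
  hasDerivAt_fst : ∀ t, HasDerivAt θ (-(a * (x t + b * Real.sin (θ t)))) t
  hasDerivAt_snd : ∀ t, HasDerivAt x (Real.sin (θ t)) t

/-! ### Global existence, continuous dependence, uniqueness and symmetry of orbits. -/

theorem field_contDiff (K₀ τ₁ τ₂ ω : ℝ) : ContDiff ℝ 1 (field K₀ τ₁ τ₂ ω) := by
  unfold field
  have h : ContDiff ℝ 1 fun p : ℝ × ℝ => Real.sin p.1 := Real.contDiff_sin.comp contDiff_fst
  exact (contDiff_const.sub (contDiff_const.mul (contDiff_snd.add (contDiff_const.mul h)))).prodMk h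

theorem field_lipschitz (K₀ τ₁ τ₂ ω : ℝ) : ∃ K : NNReal, LipschitzWith K (field K₀ τ₁ τ₂ ω) := by
  have h : LipschitzWith (1 * 1) fun p : ℝ × ℝ => Real.sin p.1 :=
    Real.lipschitzWith_sin.comp LipschitzWith.prod_fst
  have h2 := (LipschitzWith.prod_snd (α := ℝ) (β := ℝ)).add
    ((lipschitzWith_smul τ₂).comp h)
  have h3 := (LipschitzWith.const (α := ℝ × ℝ) ω).sub
    ((lipschitzWith_smul (K₀ / τ₁)).comp h2)
  exact ⟨_, h3.prodMk h⟩

/-- A globally Lipschitz, continuously differentiable vector field has global integral curves. -/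
theorem exists_isIntegralCurve_of_lipschitz {E : Type*} [NormedAddCommGroup E] [NormedSpace ℝ E]
    [CompleteSpace E] {v : E → E} (hv : ContDiff ℝ 1 v) {K : NNReal} (hK : LipschitzWith K v)
    (p : E) : ∃ γ : ℝ → E, γ 0 = p ∧ ∀ t, HasDerivAt γ (v (γ t)) t := by
  -- On the ball of radius ‖v q‖ about q the field is at most (K + 1)‖v q‖, so a curve from q stays
  -- in the ball for this time. Scaling the radius with ‖v q‖ makes the time independent of q, and
  -- local curves then extend globally.
  have hε : (0 : ℝ) < 1 / (2 * (K + 1)) := by positivity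
  set ε : ℝ := 1 / (2 * (K + 1)) with hεdef
  obtain ⟨γ, h0, hγ⟩ := exists_isMIntegralCurve_of_isMIntegralCurveOn (I := modelWithCornersSelf ℝ E)
    (M := E) (v := v) (contMDiff_vectorSpace_iff_contDiff.mpr hv) hε (fun q => by
      have hPL : IsPicardLindelof (fun _ => v) (tmin := -ε) (tmax := ε)
          ⟨0, by constructor <;> linarith⟩ q ‖v q‖₊ 0 ((K + 1) * ‖v q‖₊) K := by
        refine ⟨fun _ _ => hK.lipschitzOnWith, fun _ _ => continuousOn_const, ?_, ?_⟩
        · intro _ _ y hy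
          have h1 := hK.dist_le_mul y q
          rw [dist_eq_norm] at h1
          have h2 : ‖v y‖ ≤ ‖v y - v q‖ + ‖v q‖ := by
            simpa using norm_add_le (v y - v q) (v q)
          have h3 : dist y q ≤ ‖v q‖ := by simpa using hy
          have h4 : (K : ℝ) * dist y q ≤ K * ‖v q‖ := by gcongr
          push_cast
          linarith
        · push_cast
          simp only [sub_zero, zero_sub, neg_neg, max_self]
          rw [hεdef]
          have : ((K : ℝ) + 1) * ‖v q‖ * (1 / (2 * (K + 1))) = ‖v q‖ / 2 := by
            field_simp
          rw [this]
          linarith [norm_nonneg (v q)]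
      obtain ⟨α, hα0, hα⟩ := hPL.exists_eq_forall_mem_Icc_hasDerivWithinAt₀
      refine ⟨α, hα0, ?_⟩
      intro t ht
      refine (hasMFDerivWithinAt_iff_hasFDerivWithinAt.2 ?_)
      have h1 := ((hα t (Ioo_subset_Icc_self ht)).mono Ioo_subset_Icc_self).hasFDerivWithinAt
      have h2 : ContinuousLinearMap.smulRight (1 : ℝ →L[ℝ] ℝ) (v (α t)) =
          ContinuousLinearMap.toSpanSingleton ℝ (v (α t)) := by ext; simp
      exact h2 ▸ h1) p
  refine ⟨γ, h0, fun t => ?_⟩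
  have h1 := hasMFDerivAt_iff_hasFDerivAt.1 (hγ t)
  have h2 : ContinuousLinearMap.smulRight (1 : ℝ →L[ℝ] ℝ) (v (γ t)) =
    ContinuousLinearMap.toSpanSingleton ℝ (v (γ t)) := by ext; simp
  exact hasDerivAt_iff_hasFDerivAt.2 (h2 ▸ h1)

theorem isOrbit_iff {K₀ τ₁ τ₂ : ℝ} {θ x : ℝ → ℝ} :
    IsOrbit (K₀ / τ₁) τ₂ θ x ↔
      ∀ t, HasDerivAt (fun t => (θ t, x t)) (field K₀ τ₁ τ₂ 0 (θ t, x t)) t := by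
  constructor
  · intro h t
    have := (h.hasDerivAt_fst t).prodMk (h.hasDerivAt_snd t)
    simpa [field] using this
  · intro h
    refine ⟨fun t => ?_, fun t => ?_⟩
    · simpa [field] using (h t).hasFDerivAt.fst.hasDerivAt
    · simpa [field] using (h t).hasFDerivAt.snd.hasDerivAt

theorem exists_isOrbit (a b θ₀ x₀ : ℝ) :
    ∃ θ x : ℝ → ℝ, IsOrbit a b θ x ∧ θ 0 = θ₀ ∧ x 0 = x₀ := by
  -- Any a is K₀ / τ₁ for K₀ = a and τ₁ = 1.
  obtain ⟨K, hK⟩ := field_lipschitz a 1 b 0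
  obtain ⟨γ, h0, hγ⟩ := exists_isIntegralCurve_of_lipschitz (field_contDiff a 1 b 0) hK (θ₀, x₀)
  refine ⟨fun t => (γ t).1, fun t => (γ t).2, ?_, by simp [h0], by simp [h0]⟩
  rw [← div_one a]
  exact isOrbit_iff.2 hγ

/-- Solutions on `[0, ∞)` depend on their initial state in a Lipschitz way, uniformly on compact
time intervals. -/
theorem IsSolutionOn.dist_le (K₀ τ₁ τ₂ ω : ℝ) : ∃ K : NNReal, ∀ γ δ : ℝ → ℝ × ℝ,
    IsSolutionOn K₀ τ₁ τ₂ ω γ (Ici 0) → IsSolutionOn K₀ τ₁ τ₂ ω δ (Ici 0) →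
      ∀ t, 0 ≤ t → dist (γ t) (δ t) ≤ dist (γ 0) (δ 0) * Real.exp (K * t) := by
  obtain ⟨K, hK⟩ := field_lipschitz K₀ τ₁ τ₂ ω
  refine ⟨K, fun γ δ hγ hδ t ht => ?_⟩
  have hc : ∀ η : ℝ → ℝ × ℝ, IsSolutionOn K₀ τ₁ τ₂ ω η (Ici 0) → ContinuousOn η (Icc 0 t) :=
    fun η hη => (IsIntegralCurveOn.continuousOn hη).mono Icc_subset_Ici_self
  have hd : ∀ η : ℝ → ℝ × ℝ, IsSolutionOn K₀ τ₁ τ₂ ω η (Ici 0) → ∀ s ∈ Ico 0 t,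
      HasDerivWithinAt η (field K₀ τ₁ τ₂ ω (η s)) (Ici s) s :=
    fun η hη s hs => (hη s hs.1).mono (Ici_subset_Ici.2 hs.1)
  simpa using dist_le_of_trajectories_ODE (v := fun _ => field K₀ τ₁ τ₂ ω) (fun _ => hK) (hc γ hγ)
    (hd γ hγ) (hc δ hδ) (hd δ hδ) le_rfl t ⟨ht, le_rfl⟩

theorem IsOrbit.isSolutionOn {K₀ τ₁ τ₂ : ℝ} {θ x : ℝ → ℝ} (h : IsOrbit (K₀ / τ₁) τ₂ θ x)
    (s : Set ℝ) : IsSolutionOn K₀ τ₁ τ₂ 0 (fun t => (θ t, x t)) s :=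
  fun t _ => (isOrbit_iff.1 h t).hasDerivWithinAt

/-- Every solution on `[0, ∞)` is the restriction of an orbit. -/
theorem IsSolutionOn.exists_isOrbit {K₀ τ₁ τ₂ : ℝ} {γ : ℝ → ℝ × ℝ}
    (hγ : IsSolutionOn K₀ τ₁ τ₂ 0 γ (Ici 0)) :
    ∃ θ x, IsOrbit (K₀ / τ₁) τ₂ θ x ∧ ∀ t, 0 ≤ t → γ t = (θ t, x t) := by
  obtain ⟨θ, x, h, h0, h1⟩ := PLL.exists_isOrbit (K₀ / τ₁) τ₂ (γ 0).1 (γ 0).2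
  refine ⟨θ, x, h, fun t ht => ?_⟩
  obtain ⟨K, hK⟩ := IsSolutionOn.dist_le K₀ τ₁ τ₂ 0
  have := hK γ _ hγ (h.isSolutionOn _) t ht
  simp only [h0, h1, Prod.mk.eta, dist_self, zero_mul] at this
  exact dist_le_zero.1 this

theorem IsOrbit.dist_le (a b : ℝ) : ∃ K : ℝ, ∀ θ x θ' x' : ℝ → ℝ, IsOrbit a b θ x →
    IsOrbit a b θ' x' → ∀ t, 0 ≤ t →
      dist (θ t, x t) (θ' t, x' t) ≤ dist (θ 0, x 0) (θ' 0, x' 0) * Real.exp (K * t) := by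
  obtain ⟨K, hK⟩ := IsSolutionOn.dist_le a 1 b 0
  refine ⟨K, fun θ x θ' x' h h' t ht => ?_⟩
  rw [← div_one a] at h h'
  exact hK _ _ (h.isSolutionOn _) (h'.isSolutionOn _) t ht

/-- The orbit starting at `p`. -/
noncomputable def flow (a b : ℝ) (p : ℝ × ℝ) (t : ℝ) : ℝ × ℝ :=
  ((exists_isOrbit a b p.1 p.2).choose t, (exists_isOrbit a b p.1 p.2).choose_spec.choose t)

theorem flow_isOrbit (a b : ℝ) (p : ℝ × ℝ) :
    IsOrbit a b (fun t => (flow a b p t).1) (fun t => (flow a b p t).2) :=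
  (exists_isOrbit a b p.1 p.2).choose_spec.choose_spec.1

theorem flow_zero (a b : ℝ) (p : ℝ × ℝ) : flow a b p 0 = p :=
  Prod.ext (exists_isOrbit a b p.1 p.2).choose_spec.choose_spec.2.1
    (exists_isOrbit a b p.1 p.2).choose_spec.choose_spec.2.2

theorem IsOrbit.eq_flow {a b : ℝ} {θ x : ℝ → ℝ} (h : IsOrbit a b θ x) {t : ℝ} (ht : 0 ≤ t) :
    (θ t, x t) = flow a b (θ 0, x 0) t := by
  obtain ⟨K, hK⟩ := IsOrbit.dist_le a b
  have := hK _ _ _ _ h (flow_isOrbit a b (θ 0, x 0)) t ht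
  simp only [flow_zero, dist_self, zero_mul] at this
  exact dist_le_zero.1 this

theorem flow_continuous (a b : ℝ) {t : ℝ} (ht : 0 ≤ t) : Continuous fun p => flow a b p t := by
  obtain ⟨K, hK⟩ := IsOrbit.dist_le a b
  refine (LipschitzWith.of_dist_le_mul (K := (Real.exp (K * t)).toNNReal) fun p q => ?_).continuous
  have := hK _ _ _ _ (flow_isOrbit a b p) (flow_isOrbit a b q) t ht
  simp only [flow_zero, Prod.mk.eta] at this
  rwa [Real.coe_toNNReal _ (Real.exp_pos _).le, mul_comm]

/-- Sine is odd. This symmetry reduces starting points with x > 0 to those with x < 0. -/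
theorem IsOrbit.comp_neg {a b : ℝ} {θ x : ℝ → ℝ} (h : IsOrbit a b θ x) :
    IsOrbit a b (fun t => -θ t) (fun t => -x t) := by
  refine ⟨fun t => ?_, fun t => ?_⟩
  · refine (h.hasDerivAt_fst t).fun_neg.congr_deriv ?_
    rw [Real.sin_neg]
    ring
  · simpa only [Real.sin_neg] using (h.hasDerivAt_snd t).fun_neg

theorem IsOrbit.comp_add_const {a b : ℝ} {θ x : ℝ → ℝ} (h : IsOrbit a b θ x) (s : ℝ) :
    IsOrbit a b (fun t => θ (t + s)) (fun t => x (t + s)) :=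
  ⟨fun t => (h.hasDerivAt_fst (t + s)).comp_add_const t s,
    fun t => (h.hasDerivAt_snd (t + s)).comp_add_const t s⟩

/-- An orbit through an equilibrium is constant in positive and negative time. -/
theorem IsOrbit.eq_of_isEquilibrium {a b : ℝ} {θ x : ℝ → ℝ} (h : IsOrbit a b θ x) {s : ℝ}
    (h1 : Real.sin (θ s) = 0) (h2 : x s = 0) (t : ℝ) : θ t = θ s ∧ x t = x s := by
  obtain ⟨K, hK⟩ := field_lipschitz a 1 b 0
  rw [← div_one a] at h
  have := ODE_solution_unique_univ (v := fun _ => field a 1 b 0) (s := fun _ => univ) (K := K)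
    (f := fun t => (θ t, x t)) (g := fun _ => (θ s, x s)) (t₀ := s)
    (fun _ => hK.lipschitzOnWith) (fun t => ⟨isOrbit_iff.1 h t, trivial⟩)
    (fun t => ⟨by
      have : field a 1 b 0 (θ s, x s) = 0 := by simp [field, h1, h2]
      rw [this]; exact hasDerivAt_const _ _, trivial⟩) rfl
  simpa using congrFun this t

/-! ### Energy decay and convergence of every orbit to an equilibrium. -/

/-- Barbalat's lemma. -/
theorem tendsto_deriv_zero_of_tendsto {f g : ℝ → ℝ} {l K : ℝ}
    (hf : ∀ t, HasDerivAt f (g t) t) (hl : Tendsto f atTop (𝓝 l)) (hK : 0 ≤ K)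
    (hg : ∀ s t, 0 ≤ s → s ≤ t → |g t - g s| ≤ K * (t - s)) : Tendsto g atTop (𝓝 0) := by
  rw [Metric.tendsto_atTop]
  intro ε hε
  set η : ℝ := ε / (2 * (K + 1)) with hη
  have hη0 : 0 < η := by positivity
  have hKη : K * η < ε / 2 := by
    rw [hη, ← mul_div_assoc, div_lt_div_iff₀ (by positivity) (by positivity)]
    nlinarith
  obtain ⟨T, hT⟩ := Metric.tendsto_atTop.1 hl (η * ε / 4) (by positivity)
  refine ⟨max T 0, fun t ht => ?_⟩
  have ht0 : 0 ≤ t := (le_max_right _ _).trans ht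
  have htT : T ≤ t := (le_max_left _ _).trans ht
  -- Both values of f are within ηε/4 of the limit, so the slope g c is at most ε/2; the Lipschitz
  -- bound moves g by less than ε/2 between t and c.
  obtain ⟨c, hc, hc'⟩ := exists_hasDerivAt_eq_slope f g (show t < t + η by linarith)
    (fun s _ => (hf s).continuousAt.continuousWithinAt) (fun s _ => hf s)
  have h1 := abs_lt.1 (hT t htT)
  have h2 := abs_lt.1 (hT (t + η) (by linarith))
  have h3 := hg t c ht0 hc.1.le
  have h4 : K * (c - t) ≤ K * η := by gcongr; linarith [hc.2]
  have h5 : |g c| ≤ ε / 2 := by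
    rw [hc', add_sub_cancel_left, abs_div, abs_of_pos hη0, div_le_iff₀ hη0, abs_le]
    constructor <;> linarith [h1.1, h1.2, h2.1, h2.2]
  rw [Real.dist_eq, sub_zero]
  have h6 := abs_sub_abs_le_abs_sub (g t) (g c)
  rw [abs_sub_comm] at h6
  linarith

theorem abs_sub_le_mul_of_hasDerivAt {g g' : ℝ → ℝ} {K : ℝ} (hg : ∀ t, HasDerivAt g (g' t) t)
    (hK : ∀ t, 0 ≤ t → |g' t| ≤ K) (s t : ℝ) (hs : 0 ≤ s) (hst : s ≤ t) :
    |g t - g s| ≤ K * (t - s) := by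
  have := (convex_Ici (0 : ℝ)).norm_image_sub_le_of_norm_hasDerivWithin_le
    (fun u _ => (hg u).hasDerivWithinAt) (fun u hu => hK u hu) (x := s) (y := t) hs (hs.trans hst)
  rwa [Real.norm_eq_abs, Real.norm_eq_abs, abs_of_nonneg (sub_nonneg.2 hst)] at this

/-- The energy of the model with `ω = 0`. -/
noncomputable def energy (a : ℝ) (p : ℝ × ℝ) : ℝ := a * p.2 ^ 2 / 2 + (1 - Real.cos p.1)

theorem energy_continuous (a : ℝ) : Continuous (energy a) := by
  unfold energy
  fun_prop

theorem energy_nonneg {a : ℝ} (ha : 0 < a) (p : ℝ × ℝ) : 0 ≤ energy a p := by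
  have := Real.cos_le_one p.1
  have : 0 ≤ a * p.2 ^ 2 / 2 := by positivity
  unfold energy
  linarith

namespace IsOrbit

variable {a b : ℝ} {θ x : ℝ → ℝ}

theorem continuous_fst (h : IsOrbit a b θ x) : Continuous θ :=
  continuous_iff_continuousAt.2 fun t => (h.hasDerivAt_fst t).continuousAt

theorem continuous_snd (h : IsOrbit a b θ x) : Continuous x :=
  continuous_iff_continuousAt.2 fun t => (h.hasDerivAt_snd t).continuousAt

/-- The terms a x sin θ from the two summands cancel, leaving only the damping due to b. -/
theorem hasDerivAt_energy (h : IsOrbit a b θ x) (t : ℝ) :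
    HasDerivAt (fun t => energy a (θ t, x t)) (-(a * b * Real.sin (θ t) ^ 2)) t := by
  have h1 := (((h.hasDerivAt_snd t).pow 2).const_mul a).div_const 2
  have h2 := ((h.hasDerivAt_fst t).cos).const_sub 1
  refine (h1.add h2).congr_deriv ?_
  simp
  ring

theorem energy_antitone (ha : 0 < a) (hb : 0 < b) (h : IsOrbit a b θ x) :
    Antitone fun t => energy a (θ t, x t) :=
  antitone_of_hasDerivAt_nonpos h.hasDerivAt_energy fun t => by
    have : 0 ≤ a * b * Real.sin (θ t) ^ 2 := by positivity
    simpa using this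

theorem exists_tendsto_energy (ha : 0 < a) (hb : 0 < b) (h : IsOrbit a b θ x) :
    ∃ l, Tendsto (fun t => energy a (θ t, x t)) atTop (𝓝 l) :=
  ⟨_, tendsto_atTop_ciInf (h.energy_antitone ha hb)
    ⟨0, by rintro _ ⟨t, rfl⟩; exact energy_nonneg ha _⟩⟩

theorem exists_snd_bound (ha : 0 < a) (hb : 0 < b) (h : IsOrbit a b θ x) :
    ∃ M, ∀ t, 0 ≤ t → |x t| ≤ M := by
  refine ⟨√(2 * energy a (θ 0, x 0) / a), fun t ht => Real.abs_le_sqrt ?_⟩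
  have h1 := h.energy_antitone ha hb ht
  have h2 := Real.cos_le_one (θ t)
  rw [le_div_iff₀ ha]
  simp only [energy] at h1 ⊢
  linarith

theorem exists_deriv_fst_bound (ha : 0 < a) (hb : 0 < b) (h : IsOrbit a b θ x) :
    ∃ M, ∀ t, 0 ≤ t → |-(a * (x t + b * Real.sin (θ t)))| ≤ M := by
  obtain ⟨M, hM⟩ := h.exists_snd_bound ha hb
  refine ⟨a * (M + b), fun t ht => ?_⟩
  rw [abs_neg, abs_mul, abs_of_pos ha]
  gcongr
  refine (abs_add_le _ _).trans (add_le_add (hM t ht) ?_)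
  rw [abs_mul, abs_of_pos hb]
  exact mul_le_of_le_one_right hb.le (Real.abs_sin_le_one _)

/-- The energy converges, being monotone and bounded below. The bounds on x and θ' make its
derivative Lipschitz, so Barbalat's lemma applies; θ need not be known to be bounded. -/
theorem tendsto_sin (ha : 0 < a) (hb : 0 < b) (h : IsOrbit a b θ x) :
    Tendsto (fun t => Real.sin (θ t)) atTop (𝓝 0) := by
  obtain ⟨l, hl⟩ := h.exists_tendsto_energy ha hb
  obtain ⟨M, hM⟩ := h.exists_deriv_fst_bound ha hb
  have hM0 : 0 ≤ M := (abs_nonneg _).trans (hM 0 le_rfl)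
  have hd : ∀ t, HasDerivAt (fun t => -(a * b * Real.sin (θ t) ^ 2))
      (-(a * b * (2 * Real.sin (θ t) *
        (Real.cos (θ t) * -(a * (x t + b * Real.sin (θ t))))))) t := fun t => by
    refine (((((h.hasDerivAt_fst t).sin).pow 2).const_mul (a * b)).neg).congr_deriv ?_
    simp
  have h0 := tendsto_deriv_zero_of_tendsto h.hasDerivAt_energy hl
    (K := a * b * (2 * 1 * (1 * M))) (by positivity)
    (abs_sub_le_mul_of_hasDerivAt hd fun t ht => by
      rw [abs_neg, abs_mul (a * b), abs_mul (2 * _), abs_mul 2, abs_mul (Real.cos _),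
        abs_of_pos (mul_pos ha hb), abs_of_pos (two_pos : (0 : ℝ) < 2)]
      gcongr
      · exact Real.abs_sin_le_one _
      · exact Real.abs_cos_le_one _
      · exact hM t ht)
  have h1 : Tendsto (fun t => Real.sin (θ t) ^ 2) atTop (𝓝 0) := by
    have := h0.const_mul (-(a * b)⁻¹)
    rw [mul_zero] at this
    refine this.congr fun t => ?_
    field_simp
  have h2 := h1.sqrt
  simp only [Real.sqrt_sq_eq_abs, Real.sqrt_zero] at h2
  exact (tendsto_zero_iff_abs_tendsto_zero _).2 h2

/-- Once |sin θ| < 1 for good, θ cannot leave the strip of half-width π/2 around the nearest kπ,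
where arcsin inverts the sine up to sign and shift. -/
theorem tendsto_fst (ha : 0 < a) (hb : 0 < b) (h : IsOrbit a b θ x) :
    ∃ k : ℤ, Tendsto θ atTop (𝓝 (k * Real.pi)) := by
  have hs := h.tendsto_sin ha hb
  have habs : ∀ (k : ℤ) (y : ℝ), |Real.sin (y - k * Real.pi)| = |Real.sin y| := fun k y => by
    rw [Real.sin_sub_int_mul_pi, abs_mul]
    simp
  obtain ⟨T, hT⟩ := Metric.tendsto_atTop.1 hs 1 one_pos
  simp only [Real.dist_eq, sub_zero] at hT
  set k : ℤ := round (θ T / Real.pi) with hk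
  have hne : ∀ t, T ≤ t → |θ t - k * Real.pi| ≠ Real.pi / 2 := fun t ht heq => by
    have h1 := hT t ht
    rw [← habs k] at h1
    rcases eq_or_eq_neg_of_abs_eq heq with h2 | h2 <;> rw [h2] at h1 <;> simp at h1
  have hpi := Real.pi_pos
  have hTlt : |θ T - k * Real.pi| < Real.pi / 2 := by
    refine lt_of_le_of_ne ?_ (hne T le_rfl)
    have h1 := abs_sub_round (θ T / Real.pi)
    rw [← hk] at h1
    have h2 : θ T - k * Real.pi = (θ T / Real.pi - k) * Real.pi := by field_simp
    rw [h2, abs_mul, abs_of_pos hpi]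
    nlinarith
  have hlt : ∀ t, T ≤ t → |θ t - k * Real.pi| < Real.pi / 2 := fun t ht => by
    by_contra! hge
    have hc : ContinuousOn (fun t => |θ t - k * Real.pi|) (Icc T t) :=
      (h.continuous_fst.sub continuous_const).abs.continuousOn
    obtain ⟨s, hs1, hs2⟩ := intermediate_value_Icc ht hc ⟨hTlt.le, hge⟩
    exact hne s hs1.1 hs2
  refine ⟨k, ?_⟩
  have h1 : Tendsto (fun t => Real.sin (θ t - k * Real.pi)) atTop (𝓝 0) := by
    rw [tendsto_zero_iff_abs_tendsto_zero] at hs ⊢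
    exact hs.congr fun t => (habs k _).symm
  have h2 := ((Real.continuous_arcsin.tendsto 0).comp h1).add_const (k * Real.pi)
  rw [Real.arcsin_zero, zero_add] at h2
  refine h2.congr' ?_
  filter_upwards [eventually_ge_atTop T] with t ht
  have h3 := abs_lt.1 (hlt t ht)
  simp only [Function.comp]
  rw [Real.arcsin_sin (by linarith [h3.1]) h3.2.le]
  ring

/-- Barbalat's lemma for θ itself gives θ' → 0, and sin θ → 0 is already known. -/
theorem tendsto_snd (ha : 0 < a) (hb : 0 < b) (h : IsOrbit a b θ x) :
    Tendsto x atTop (𝓝 0) := by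
  obtain ⟨k, hk⟩ := h.tendsto_fst ha hb
  obtain ⟨M, hM⟩ := h.exists_deriv_fst_bound ha hb
  have hM0 : 0 ≤ M := (abs_nonneg _).trans (hM 0 le_rfl)
  have hd : ∀ t, HasDerivAt (fun t => -(a * (x t + b * Real.sin (θ t))))
      (-(a * (Real.sin (θ t) +
        b * (Real.cos (θ t) * -(a * (x t + b * Real.sin (θ t))))))) t := fun t =>
    (((h.hasDerivAt_snd t).add ((h.hasDerivAt_fst t).sin.const_mul b)).const_mul a).neg
  have h0 := tendsto_deriv_zero_of_tendsto h.hasDerivAt_fst hk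
    (K := a * (1 + b * (1 * M))) (by positivity)
    (abs_sub_le_mul_of_hasDerivAt hd fun t ht => by
      rw [abs_neg, abs_mul a, abs_of_pos ha]
      gcongr
      refine (abs_add_le _ _).trans (add_le_add (Real.abs_sin_le_one _) ?_)
      rw [abs_mul b, abs_mul (Real.cos _), abs_of_pos hb]
      gcongr
      · exact Real.abs_cos_le_one _
      · exact hM t ht)
  have h1 := (h0.const_mul (-a⁻¹)).sub ((h.tendsto_sin ha hb).const_mul b)
  simp only [mul_zero, sub_zero] at h1
  refine h1.congr fun t => ?_
  field_simp
  ring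

/-- A decreasing energy stays above its limit, which is 2 at a saddle. -/
theorem le_energy_of_tendsto (ha : 0 < a) (hb : 0 < b) (h : IsOrbit a b θ x) {k : ℤ}
    (hk : Odd k) (hθ : Tendsto θ atTop (𝓝 (k * Real.pi))) (t : ℝ) :
    2 ≤ energy a (θ t, x t) := by
  have h1 := ((energy_continuous a).tendsto _).comp (hθ.prodMk_nhds (h.tendsto_snd ha hb))
  have h2 : energy a (k * Real.pi, 0) = 2 := by
    have : Real.cos (k * Real.pi) = -1 := by rw [Real.cos_int_mul_pi, hk.neg_one_zpow]
    simp only [energy, this]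
    norm_num
  rw [h2] at h1
  exact (h.energy_antitone ha hb).le_of_tendsto h1 t

theorem even_of_energy_lt (ha : 0 < a) (hb : 0 < b) (h : IsOrbit a b θ x) {k : ℤ}
    (hθ : Tendsto θ atTop (𝓝 (k * Real.pi))) {t : ℝ} (ht : energy a (θ t, x t) < 2) : Even k := by
  by_contra hk
  exact absurd (h.le_energy_of_tendsto ha hb (Int.not_even_iff_odd.1 hk) hθ t) (not_le.2 ht)

/-- As long as the energy is at least that of the saddles, `x` does not vanish. -/
theorem snd_neg_of_le_energy (ha : 0 < a) (hb : 0 < b) (h : IsOrbit a b θ x) (h0 : x 0 < 0)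
    {s t : ℝ} (ht : 2 ≤ energy a (θ t, x t)) (hs : 0 ≤ s) (hst : s ≤ t) : x s < 0 := by
  by_contra! hx
  obtain ⟨r, hr, hr0⟩ := intermediate_value_Icc hs h.continuous_snd.continuousOn ⟨h0.le, hx⟩
  have h1 := ht.trans (h.energy_antitone ha hb (hr.2.trans hst))
  -- Energy at least 2 with x = 0 forces cos θ = -1: the orbit sits at a saddle and is constant.
  simp only [energy, hr0] at h1
  have h2 := Real.neg_one_le_cos (θ r)
  have h3 : Real.cos (θ r) = -1 := by linarith
  have h4 : Real.sin (θ r) = 0 := by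
    have := Real.sin_sq_add_cos_sq (θ r)
    rw [h3] at this
    nlinarith
  have := (h.eq_of_isEquilibrium h4 hr0 0).2
  linarith

end IsOrbit

/-! ### Barrier arguments and one-way crossing of the lines θ = kπ. -/

/-- A function which increases through the level `c` stays above it. -/
theorem le_of_deriv_pos_of_eq {f f' : ℝ → ℝ} (hf : ∀ t, HasDerivAt f (f' t) t) {c t₁ t₂ : ℝ}
    (h12 : t₁ ≤ t₂) (h0 : c ≤ f t₁) (h : ∀ t ∈ Icc t₁ t₂, f t = c → 0 < f' t) : c ≤ f t₂ := by
  have hc : ContinuousOn f (Icc t₁ t₂) := fun t _ => (hf t).continuousAt.continuousWithinAt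
  have := image_le_of_liminf_slope_right_lt_deriv_boundary' (f := fun t => -f t)
    (f' := fun t => -f' t) (a := t₁) (b := t₂) (B := fun _ => -c) (B' := fun _ => 0) hc.neg
    (fun t _ r hr => ((hf t).neg.hasDerivWithinAt).liminf_right_slope_le hr) (by simpa using h0)
    continuousOn_const (fun t _ => hasDerivWithinAt_const _ _ _)
    (fun t ht heq => by
      have := h t (Ico_subset_Icc_self ht) (by simpa using heq)
      linarith) (right_mem_Icc.2 h12)
  simpa using this

/-- A function which does not decrease while positive does not decrease at all. -/
theorem le_of_deriv_nonneg_of_pos {f f' : ℝ → ℝ} {t₁ t₂ : ℝ} (hf : ContinuousOn f (Icc t₁ t₂))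
    (hd : ∀ t ∈ Ioo t₁ t₂, HasDerivAt f (f' t) t)
    (h12 : t₁ ≤ t₂) (h0 : 0 < f t₁) (h : ∀ t ∈ Ioo t₁ t₂, 0 < f t → 0 ≤ f' t) : f t₁ ≤ f t₂ := by
  have key : ∀ s ∈ Icc t₁ t₂, (∀ r ∈ Icc t₁ s, 0 < f r) → f t₁ ≤ f s := fun s hs hr => by
    refine monotoneOn_of_hasDerivWithinAt_nonneg (f' := f') (convex_Icc t₁ s)
      (hf.mono (Icc_subset_Icc_right hs.2)) ?_ ?_ (left_mem_Icc.2 hs.1) (right_mem_Icc.2 hs.1) hs.1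
    · intro r hr'
      rw [interior_Icc] at hr' ⊢
      exact (hd r ⟨hr'.1, hr'.2.trans_le hs.2⟩).hasDerivWithinAt
    · intro r hr'
      rw [interior_Icc] at hr'
      exact h r ⟨hr'.1, hr'.2.trans_le hs.2⟩ (hr r (Ioo_subset_Icc_self hr'))
  refine key t₂ (right_mem_Icc.2 h12) ?_
  by_contra! hneg
  obtain ⟨r, hr, hfr⟩ := hneg
  -- Before the first time s with f s ≤ 0 the function is at least f t₁; continuity carries this
  -- bound to s.
  have hne : (Icc t₁ t₂ ∩ f ⁻¹' Iic 0).Nonempty := ⟨r, hr, hfr⟩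
  have hcl : IsCompact (Icc t₁ t₂ ∩ f ⁻¹' Iic 0) :=
    isCompact_Icc.of_isClosed_subset (hf.preimage_isClosed_of_isClosed isClosed_Icc isClosed_Iic)
      inter_subset_left
  obtain ⟨s, ⟨hs, hfs⟩, hleast⟩ := hcl.exists_isLeast hne
  have hfs' : f s ≤ 0 := hfs
  have hlt : t₁ < s := lt_of_le_of_ne hs.1 fun heq => by rw [← heq] at hfs'; linarith
  have hpos : ∀ r ∈ Ico t₁ s, 0 < f r := fun r hr => by
    by_contra! hr'
    have := hleast ⟨⟨hr.1, hr.2.le.trans hs.2⟩, hr'⟩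
    linarith [hr.2]
  have hge : ∀ r ∈ Ico t₁ s, f t₁ ≤ f r := fun r hr =>
    key r ⟨hr.1, hr.2.le.trans hs.2⟩ fun u hu => hpos u ⟨hu.1, hu.2.trans_lt hr.2⟩
  have : f t₁ ≤ f s := by
    refine ContinuousWithinAt.closure_le (s := Ico t₁ s) ?_ continuousWithinAt_const
      ((hf s hs).mono fun u hu => ⟨hu.1, hu.2.le.trans hs.2⟩) hge
    rw [closure_Ico hlt.ne]
    exact right_mem_Icc.2 hlt.le
  linarith
namespace IsOrbit

variable {a b : ℝ} {θ x : ℝ → ℝ}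

/-- While `x < 0`, the lines `θ = k π` are crossed only in the direction of increasing `θ`. -/
theorem int_mul_pi_le (ha : 0 < a) (h : IsOrbit a b θ x) {k : ℤ} {t₁ t₂ : ℝ} (h12 : t₁ ≤ t₂)
    (hx : ∀ t ∈ Icc t₁ t₂, x t < 0) (hk : k * Real.pi ≤ θ t₁) : k * Real.pi ≤ θ t₂ := by
  refine le_of_deriv_pos_of_eq h.hasDerivAt_fst h12 hk fun t ht heq => ?_
  rw [heq, Real.sin_int_mul_pi, mul_zero, add_zero]
  nlinarith [hx t ht]

/-- No orbit with `x < 0` tends to a saddle from the right. -/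
theorem not_tendsto_of_le (ha : 0 < a) (hb : 0 < b) (h : IsOrbit a b θ x) {k : ℤ} (hk : Odd k)
    (hx : ∀ t, 0 ≤ t → x t < 0) {t₁ : ℝ} (hle : ∀ t, t₁ ≤ t → k * Real.pi ≤ θ t) :
    ¬ Tendsto θ atTop (𝓝 (k * Real.pi)) := fun hθ => by
  have hev := hθ.eventually (gt_mem_nhds (show k * Real.pi < k * Real.pi + Real.pi by
    linarith [Real.pi_pos]))
  obtain ⟨T, hT⟩ := eventually_atTop.1 hev
  set S := max (max T t₁) 0
  have hsin : ∀ t, S ≤ t → Real.sin (θ t) ≤ 0 := fun t ht => by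
    have h1 := hT t (((le_max_left _ _).trans (le_max_left _ _)).trans ht)
    have h2 := hle t (((le_max_right _ _).trans (le_max_left _ _)).trans ht)
    have h3 := Real.sin_nonneg_of_nonneg_of_le_pi (x := θ t - k * Real.pi) (by linarith)
      (by linarith)
    rw [Real.sin_sub_int_mul_pi, hk.neg_one_zpow] at h3
    linarith
  -- Just right of a saddle the sine is nonpositive, so x decreases; having limit 0 it would have to
  -- be nonnegative.
  have hanti : AntitoneOn x (Ici S) :=
    antitoneOn_of_hasDerivWithinAt_nonpos (convex_Ici S) h.continuous_snd.continuousOn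
      (fun t _ => (h.hasDerivAt_snd t).hasDerivWithinAt)
      (fun t ht => hsin t (interior_subset ht))
  have h1 : 0 ≤ x S := le_of_tendsto (h.tendsto_snd ha hb) <| by
    filter_upwards [eventually_ge_atTop S] with t ht
    exact hanti self_mem_Ici ht ht
  exact absurd (hx S (le_max_right _ _)) (not_lt.2 h1)

end IsOrbit

/-! ### Separatrix orbits: monotonicity in θ and uniqueness. -/

/-- Orbits on the lower separatrix of the saddle `(π, 0)`, for `ω = 0`. -/
structure IsSeparatrixOrbit (a b : ℝ) (θ x : ℝ → ℝ) : Prop extends IsOrbit a b θ x where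
  tendsto_pi : Tendsto θ atTop (𝓝 Real.pi)
  eventually_neg : ∀ᶠ t in atTop, x t < 0

namespace IsSeparatrixOrbit

variable {a b : ℝ} {θ x : ℝ → ℝ}

theorem tendsto_one (h : IsSeparatrixOrbit a b θ x) :
    Tendsto θ atTop (𝓝 ((1 : ℤ) * Real.pi)) := by simpa using h.tendsto_pi

theorem le_energy (ha : 0 < a) (hb : 0 < b) (h : IsSeparatrixOrbit a b θ x) (t : ℝ) :
    2 ≤ energy a (θ t, x t) := h.toIsOrbit.le_energy_of_tendsto ha hb odd_one h.tendsto_one t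

theorem snd_neg (ha : 0 < a) (hb : 0 < b) (h : IsSeparatrixOrbit a b θ x) (t : ℝ) : x t < 0 := by
  obtain ⟨T, hT⟩ := eventually_atTop.1 h.eventually_neg
  by_contra! hx
  set S := max T t
  have hS : x S < 0 := hT S (le_max_left _ _)
  obtain ⟨r, hr, hr0⟩ := intermediate_value_Icc' (le_max_right T t)
    h.continuous_snd.continuousOn ⟨hS.le, hx⟩
  have h1 := h.le_energy ha hb r
  simp only [energy, hr0] at h1
  have h2 := Real.neg_one_le_cos (θ r)
  have h3 : Real.cos (θ r) = -1 := by linarith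
  have h4 : Real.sin (θ r) = 0 := by
    have := Real.sin_sq_add_cos_sq (θ r)
    rw [h3] at this
    nlinarith
  have := (h.toIsOrbit.eq_of_isEquilibrium h4 hr0 S).2
  linarith

/-- After reaching π the orbit would stay on its right, from where the saddle cannot be approached
with x < 0. -/
theorem fst_lt_pi (ha : 0 < a) (hb : 0 < b) (h : IsSeparatrixOrbit a b θ x) (t : ℝ) :
    θ t < Real.pi := by
  by_contra! ht
  exact h.toIsOrbit.not_tendsto_of_le ha hb odd_one (fun s _ => h.snd_neg ha hb s) (t₁ := t)
    (fun s hs => h.toIsOrbit.int_mul_pi_le ha hs (fun r _ => h.snd_neg ha hb r) (by simpa using ht))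
    h.tendsto_one

/-- This says θ' > 0. Where x + b sin θ vanishes, x < 0 makes sin θ, hence its derivative, positive.
So once nonnegative it stays so, and θ would decrease from below π to its limit π. -/
theorem add_sin_neg (ha : 0 < a) (hb : 0 < b) (h : IsSeparatrixOrbit a b θ x) (t : ℝ) :
    x t + b * Real.sin (θ t) < 0 := by
  by_contra! ht
  have hd : ∀ t, HasDerivAt (fun t => x t + b * Real.sin (θ t)) (Real.sin (θ t) +
      b * (Real.cos (θ t) * -(a * (x t + b * Real.sin (θ t))))) t := fun t =>
    (h.hasDerivAt_snd t).add ((h.hasDerivAt_fst t).sin.const_mul b)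
  have hge : ∀ s, t ≤ s → 0 ≤ x s + b * Real.sin (θ s) := fun s hs => by
    refine le_of_deriv_pos_of_eq hd hs ht fun r _ hr => ?_
    rw [hr]
    have := h.snd_neg ha hb r
    have : 0 < b * Real.sin (θ r) := by linarith
    have := (mul_pos_iff_of_pos_left hb).1 this
    simpa using this
  have hanti : AntitoneOn θ (Ici t) :=
    antitoneOn_of_hasDerivWithinAt_nonpos (convex_Ici t) h.continuous_fst.continuousOn
      (fun s _ => (h.hasDerivAt_fst s).hasDerivWithinAt)
      (fun s hs => by
        have := hge s (interior_subset hs)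
        have : 0 ≤ a * (x s + b * Real.sin (θ s)) := by positivity
        linarith)
  have h1 : Real.pi ≤ θ t := le_of_tendsto h.tendsto_pi <| by
    filter_upwards [eventually_ge_atTop t] with s hs
    exact hanti self_mem_Ici hs hs
  exact absurd (h.fst_lt_pi ha hb t) (not_lt.2 h1)

theorem deriv_fst_pos (ha : 0 < a) (hb : 0 < b) (h : IsSeparatrixOrbit a b θ x) (t : ℝ) :
    0 < -(a * (x t + b * Real.sin (θ t))) := by
  nlinarith [h.add_sin_neg ha hb t]

theorem strictMono_fst (ha : 0 < a) (hb : 0 < b) (h : IsSeparatrixOrbit a b θ x) :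
    StrictMono θ :=
  strictMono_of_hasDerivAt_pos h.hasDerivAt_fst (h.deriv_fst_pos ha hb)

/-- A separatrix orbit, parametrized by `θ`. -/
theorem exists_param (ha : 0 < a) (hb : 0 < b) (h : IsSeparatrixOrbit a b θ x) :
    ∃ T : ℝ → ℝ, T (θ 0) = 0 ∧ ∀ u ∈ Ico (θ 0) Real.pi, θ (T u) = u ∧
      HasDerivAt T (-(a * (x (T u) + b * Real.sin u)))⁻¹ u := by
  have hmono := h.strictMono_fst ha hb
  have hopen : IsOpen (range θ) := by
    refine isOpen_iff_mem_nhds.2 ?_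
    rintro _ ⟨t, rfl⟩
    refine mem_of_superset (Icc_mem_nhds (hmono (sub_one_lt t)) (hmono (lt_add_one t))) ?_
    exact (intermediate_value_Icc (by linarith) h.continuous_fst.continuousOn).trans
      (image_subset_range _ _)
  set T := Function.invFun θ
  have hleft : ∀ t, T (θ t) = t := Function.leftInverse_invFun hmono.injective
  have hright : ∀ u ∈ range θ, θ (T u) = u := fun u hu => Function.invFun_eq hu
  have hcont : ∀ u ∈ range θ, ContinuousAt T u := fun u hu => by
    refine StrictMonoOn.continuousAt_of_image_mem_nhds (s := range θ) ?_ (hopen.mem_nhds hu) ?_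
    · rintro _ ⟨r, rfl⟩ _ ⟨s, rfl⟩ hrs
      rw [hleft, hleft]
      exact hmono.lt_iff_lt.1 hrs
    · have : T '' range θ = univ := by
        refine eq_univ_of_forall fun t => ⟨θ t, mem_range_self t, hleft t⟩
      rw [this]
      exact univ_mem
  have hrange : Ico (θ 0) Real.pi ⊆ range θ := fun u hu => by
    obtain ⟨s, hs⟩ := (h.tendsto_pi.eventually (lt_mem_nhds hu.2)).exists
    rcases le_total 0 s with hs0 | hs0
    · obtain ⟨r, -, hr⟩ := intermediate_value_Icc hs0 h.continuous_fst.continuousOn ⟨hu.1, hs.le⟩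
      exact ⟨r, hr⟩
    · linarith [hmono.monotone hs0, hu.1]
  refine ⟨T, hleft 0, fun u hu => ⟨hright u (hrange hu), ?_⟩⟩
  have hu' := hrange hu
  have h1 := h.hasDerivAt_fst (T u)
  have h2 := h.deriv_fst_pos ha hb (T u)
  rw [hright u hu'] at h1 h2
  exact HasDerivAt.of_local_left_inverse (hcont u hu') h1 h2.ne'
    (by filter_upwards [hopen.mem_nhds hu'] with v hv using hright v hv)

/-- Through every `θ₀ < π` passes at most one separatrix orbit. -/
theorem snd_unique (ha : 0 < a) (hb : 0 < b) {θ' x' : ℝ → ℝ} (h : IsSeparatrixOrbit a b θ x)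
    (h' : IsSeparatrixOrbit a b θ' x') (h0 : θ 0 = θ' 0) : x' 0 ≤ x 0 := by
  by_contra! hlt
  obtain ⟨T, hT0, hT⟩ := h.exists_param ha hb
  obtain ⟨T', hT0', hT'⟩ := h'.exists_param ha hb
  rw [← h0] at hT0' hT'
  -- Comparing x² rather than x gives the derivative of the difference a factor sin² θ, so its sign
  -- does not depend on that of the sine.
  set D : ℝ → ℝ := fun u => x (T u) ^ 2 - x' (T' u) ^ 2 with hD
  have hd : ∀ u ∈ Ico (θ 0) Real.pi, HasDerivAt D
      (2 * x (T u) * (Real.sin u * (-(a * (x (T u) + b * Real.sin u)))⁻¹) -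
        2 * x' (T' u) * (Real.sin u * (-(a * (x' (T' u) + b * Real.sin u)))⁻¹)) u := by
    intro u hu
    have h1 := ((h.hasDerivAt_snd (T u)).comp u (hT u hu).2).pow 2
    have h2 := ((h'.hasDerivAt_snd (T' u)).comp u (hT' u hu).2).pow 2
    rw [(hT u hu).1] at h1
    rw [(hT' u hu).1] at h2
    refine (h1.sub h2).congr_deriv ?_
    simp
  have hD0 : 0 < D (θ 0) := by
    have h2 := h'.snd_neg ha hb 0
    simp only [hD, hT0, hT0']
    nlinarith
  have hge : ∀ u ∈ Ico (θ 0) Real.pi, D (θ 0) ≤ D u := by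
    intro u hu
    refine le_of_deriv_nonneg_of_pos (fun v hv => (hd v ⟨hv.1, hv.2.trans_lt hu.2⟩).continuousAt
      |>.continuousWithinAt) (fun v hv => hd v ⟨hv.1.le, hv.2.trans hu.2⟩) hu.1 hD0 ?_
    intro v hv hpos
    have hv' : v ∈ Ico (θ 0) Real.pi := ⟨hv.1.le, hv.2.trans hu.2⟩
    have n1 := h.snd_neg ha hb (T v)
    have n2 := h'.snd_neg ha hb (T' v)
    have m1 := h.add_sin_neg ha hb (T v)
    have m2 := h'.add_sin_neg ha hb (T' v)
    rw [(hT v hv').1] at m1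
    rw [(hT' v hv').1] at m2
    simp only [hD] at hpos
    generalize x (T v) = p at *
    generalize x' (T' v) = q at *
    generalize Real.sin v = s at *
    have hpq : p < q := by nlinarith
    have e : 2 * p * (s * (-(a * (p + b * s)))⁻¹) - 2 * q * (s * (-(a * (q + b * s)))⁻¹) =
        2 * b * s ^ 2 * (q - p) / (a * ((p + b * s) * (q + b * s))) := by
      -- Naming the denominators lets `field_simp` treat them as nonzero atoms.
      obtain ⟨P, rfl⟩ : ∃ P, p = P - b * s := ⟨p + b * s, by ring⟩
      obtain ⟨R, rfl⟩ : ∃ R, q = R - b * s := ⟨q + b * s, by ring⟩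
      rw [sub_add_cancel] at m1 m2 ⊢
      rw [sub_add_cancel]
      have := m1.ne
      have := m2.ne
      field_simp
      ring
    rw [e]
    have := mul_pos_of_neg_of_neg m1 m2
    have : 0 < q - p := by linarith
    positivity
  -- D is at most x², which vanishes at the saddle, while D stays above its positive initial value.
  have hlim : Tendsto (fun t => x t ^ 2) atTop (𝓝 0) := by
    simpa using (h.toIsOrbit.tendsto_snd ha hb).pow 2
  obtain ⟨t, ht, ht0⟩ := ((hlim.eventually (gt_mem_nhds hD0)).and (eventually_ge_atTop 0)).exists
  have hmono := h.strictMono_fst ha hb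
  have hu : θ t ∈ Ico (θ 0) Real.pi := ⟨hmono.monotone ht0, h.fst_lt_pi ha hb t⟩
  have h1 := hge _ hu
  have h2 : T (θ t) = t := hmono.injective (hT _ hu).1
  simp only [hD, h2] at h1 ht
  nlinarith [sq_nonneg (x' (T' (θ t)))]

end IsSeparatrixOrbit
-- The alternatives for orbits starting with x < 0: overshoot, capture, separatrix.
theorem energy_eq_of_odd {a : ℝ} {k : ℤ} (hk : Odd k) {θ x : ℝ}
    (hθ : θ = k * Real.pi) : 2 + a * x ^ 2 / 2 = energy a (θ, x) := by
  have : Real.cos (k * Real.pi) = -1 := by rw [Real.cos_int_mul_pi, hk.neg_one_zpow]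
  simp only [energy, hθ, this]
  ring

namespace IsOrbit

variable {a b : ℝ} {θ x : ℝ → ℝ}

theorem two_le_energy_of_eq (ha : 0 < a) {k : ℤ} (hk : Odd k) {t : ℝ} (hθ : θ t = k * Real.pi) :
    2 ≤ energy a (θ t, x t) := by
  rw [← energy_eq_of_odd hk hθ]
  have : 0 ≤ a * x t ^ 2 / 2 := by positivity
  linarith

/-- While `x < 0`, an orbit stays to the right of the saddles which it has passed. -/
theorem int_mul_pi_lt (ha : 0 < a) (hb : 0 < b) (h : IsOrbit a b θ x) {k : ℤ} (hk : Odd k)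
    {t₁ t₂ : ℝ} (h12 : t₁ ≤ t₂) (hx : ∀ t ∈ Icc t₁ t₂, x t < 0) (hlt : k * Real.pi < θ t₁) :
    k * Real.pi < θ t₂ := by
  have hpi := Real.pi_pos
  -- The barrier is a level strictly right of kπ, capped at kπ + π so that the sine there is
  -- nonpositive and θ' > 0.
  have h1 : k * Real.pi < min (θ t₁) (k * Real.pi + Real.pi) := lt_min hlt (by linarith)
  refine h1.trans_le (le_of_deriv_pos_of_eq h.hasDerivAt_fst h12 (min_le_left _ _) ?_)
  intro t ht heq
  rw [heq]
  have h3 := Real.sin_nonneg_of_nonneg_of_le_pi (x := min (θ t₁) (k * Real.pi + Real.pi) -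
    k * Real.pi) (by linarith) (by linarith [min_le_right (θ t₁) (k * Real.pi + Real.pi)])
  rw [Real.sin_sub_int_mul_pi, hk.neg_one_zpow] at h3
  have h4 := hx t ht
  have h5 : x t + b * Real.sin (min (θ t₁) (k * Real.pi + Real.pi)) < 0 := by nlinarith
  nlinarith

/-- Returning to the line of a saddle needs energy at least 2, which keeps x < 0 up to that moment,
so the one-way crossing applies. -/
theorem int_mul_pi_lt_of_neg (ha : 0 < a) (hb : 0 < b) (h : IsOrbit a b θ x) (h0 : x 0 < 0) {k : ℤ}
    (hk : Odd k) {t₁ t₂ : ℝ} (h1 : 0 ≤ t₁) (h12 : t₁ ≤ t₂) (hlt : k * Real.pi < θ t₁) :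
    k * Real.pi < θ t₂ := by
  by_contra! hle
  obtain ⟨s, hs, hsk⟩ := intermediate_value_Icc' h12 h.continuous_fst.continuousOn ⟨hle, hlt.le⟩
  have := h.int_mul_pi_lt ha hb hk hs.1 (fun t ht => h.snd_neg_of_le_energy ha hb h0
    (two_le_energy_of_eq ha hk hsk) (h1.trans ht.1) ht.2) hlt
  linarith

theorem one_lt_of_tendsto (ha : 0 < a) (hb : 0 < b) (h : IsOrbit a b θ x) (h0 : x 0 < 0)
    {t₁ : ℝ} (h1 : 0 ≤ t₁) (hlt : Real.pi < θ t₁) {k : ℤ}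
    (hk : Tendsto θ atTop (𝓝 (k * Real.pi))) : 1 < k := by
  have hge : ∀ t, t₁ ≤ t → (1 : ℤ) * Real.pi < θ t := fun t ht =>
    h.int_mul_pi_lt_of_neg ha hb h0 odd_one h1 ht (by simpa using hlt)
  have hle : (1 : ℤ) * Real.pi ≤ k * Real.pi :=
    ge_of_tendsto hk (by filter_upwards [eventually_ge_atTop t₁] with t ht using (hge t ht).le)
  have hk1 : (1 : ℤ) ≤ k := by exact_mod_cast le_of_mul_le_mul_right hle Real.pi_pos
  refine lt_of_le_of_ne hk1 ?_
  rintro rfl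
  exact h.not_tendsto_of_le ha hb odd_one (fun t ht => h.snd_neg_of_le_energy ha hb h0
    (h.le_energy_of_tendsto ha hb odd_one hk t) ht le_rfl) (fun t ht => (hge t ht).le) hk

/-- The lines θ = ±π carry energy at least 2 and cannot be reached. -/
theorem abs_fst_lt_pi (ha : 0 < a) (hb : 0 < b) (h : IsOrbit a b θ x) {t : ℝ}
    (hE : energy a (θ t, x t) < 2) (hlt : |θ t| < Real.pi) {s : ℝ} (hs : t ≤ s) :
    |θ s| < Real.pi := by
  by_contra! hge
  obtain ⟨r, hr, hrpi⟩ := intermediate_value_Icc hs h.continuous_fst.abs.continuousOn ⟨hlt.le, hge⟩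
  have h1 := h.energy_antitone ha hb hr.1
  have h2 : 2 ≤ energy a (θ r, x r) := by
    rcases eq_or_eq_neg_of_abs_eq hrpi with h3 | h3
    · exact two_le_energy_of_eq ha odd_one (by simpa using h3)
    · exact two_le_energy_of_eq ha (k := -1) (by decide) (by simpa using h3)
  simp only at h1
  linarith

theorem tendsto_zero_of_energy_lt (ha : 0 < a) (hb : 0 < b) (h : IsOrbit a b θ x) {t : ℝ}
    (hE : energy a (θ t, x t) < 2) (hlt : |θ t| < Real.pi) : Tendsto θ atTop (𝓝 0) := by
  obtain ⟨k, hk⟩ := h.tendsto_fst ha hb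
  have h1 : |k * Real.pi| ≤ Real.pi := le_of_tendsto hk.abs <| by
    filter_upwards [eventually_ge_atTop t] with s hs using (h.abs_fst_lt_pi ha hb hE hlt hs).le
  rw [abs_mul, abs_of_pos Real.pi_pos] at h1
  have h2 : |(k : ℝ)| ≤ 1 := le_of_mul_le_mul_right (by simpa using h1) Real.pi_pos
  have h3 : |k| ≤ 1 := by exact_mod_cast h2
  have h4 := h.even_of_energy_lt ha hb hk hE
  have h5 : k = 0 := by
    obtain ⟨m, rfl⟩ := h4
    have := abs_le.1 h3
    omega
  simpa [h5] using hk

theorem tendsto_zero_of_neg (ha : 0 < a) (hb : 0 < b) (h : IsOrbit a b θ x) (h0 : x 0 < 0)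
    (hθ : -Real.pi < θ 0) {t : ℝ} (ht : 0 ≤ t) (hE : energy a (θ t, x t) < 2)
    (hlt : θ t < Real.pi) : Tendsto θ atTop (𝓝 0) := by
  refine h.tendsto_zero_of_energy_lt ha hb hE (abs_lt.2 ⟨?_, hlt⟩)
  simpa using h.int_mul_pi_lt_of_neg ha hb h0 (k := -1) (by decide) le_rfl ht (by simpa using hθ)

/-- Turns touching θ = π into strict inequalities, so that overshooting is an open condition: at the
contact x < 0, hence energy > 2 and θ' > 0, and both persist a little later. -/
theorem exists_pi_lt (ha : 0 < a) (hb : 0 < b) (h : IsOrbit a b θ x) (h0 : x 0 < 0)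
    (hθ : θ 0 < Real.pi) {t : ℝ} (ht : 0 ≤ t) (hge : Real.pi ≤ θ t) :
    ∃ s, 0 ≤ s ∧ 2 < energy a (θ s, x s) ∧ Real.pi < θ s := by
  obtain ⟨s, hs, hsk⟩ := intermediate_value_Icc ht h.continuous_fst.continuousOn ⟨hθ.le, hge⟩
  have hsk' : θ s = (1 : ℤ) * Real.pi := by simpa using hsk
  have hx := h.snd_neg_of_le_energy ha hb h0 (two_le_energy_of_eq ha odd_one hsk') hs.1 le_rfl
  have hE : 2 < energy a (θ s, x s) := by
    rw [← energy_eq_of_odd odd_one hsk']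
    have : 0 < a * x s ^ 2 / 2 := by have := hx.ne; positivity
    linarith
  have hE' : ∀ᶠ r in 𝓝 s, 2 < energy a (θ r, x r) :=
    ((energy_continuous a).comp (h.continuous_fst.prodMk h.continuous_snd)).continuousAt.eventually
      (lt_mem_nhds hE)
  have hd : ∀ᶠ r in 𝓝[>] s, 0 < slope θ s r := by
    have h1 := (hasDerivAt_iff_tendsto_slope.1 (h.hasDerivAt_fst s)).mono_left
      (nhdsWithin_mono s (fun r (hr : r ∈ Ioi s) => ne_of_gt hr))
    refine h1.eventually (lt_mem_nhds ?_)
    rw [hsk, Real.sin_pi]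
    nlinarith
  obtain ⟨r, hr, hEr, hrs⟩ :=
    (hd.and ((hE'.filter_mono nhdsWithin_le_nhds).and self_mem_nhdsWithin)).exists
  have hrs' : s < r := hrs
  refine ⟨r, hs.1.trans hrs'.le, hEr, ?_⟩
  rw [slope_def_field, div_pos_iff_of_pos_right (by linarith)] at hr
  linarith

/-- The limit kπ has k odd by the energy bound and |k| ≤ 1; k = -1 would mean approaching a saddle
from the right. -/
theorem isSeparatrixOrbit (ha : 0 < a) (hb : 0 < b) (h : IsOrbit a b θ x) (h0 : x 0 < 0)
    (hθ : -Real.pi < θ 0) (hlt : ∀ t, 0 ≤ t → θ t < Real.pi)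
    (hE : ∀ t, 0 ≤ t → 2 ≤ energy a (θ t, x t)) : IsSeparatrixOrbit a b θ x := by
  have hx : ∀ t, 0 ≤ t → x t < 0 := fun t ht => h.snd_neg_of_le_energy ha hb h0 (hE t ht) ht le_rfl
  have hgt : ∀ t, 0 ≤ t → (-1 : ℤ) * Real.pi < θ t := fun t ht =>
    h.int_mul_pi_lt_of_neg ha hb h0 (by decide) le_rfl ht (by simpa using hθ)
  obtain ⟨k, hk⟩ := h.tendsto_fst ha hb
  have hodd : Odd k := by
    rw [← Int.not_even_iff_odd]
    intro hev
    have h1 := ((energy_continuous a).tendsto _).comp (hk.prodMk_nhds (h.tendsto_snd ha hb))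
    have h2 : energy a (k * Real.pi, 0) = 0 := by
      have : Real.cos (k * Real.pi) = 1 := by rw [Real.cos_int_mul_pi, hev.neg_one_zpow]
      simp [energy, this]
    rw [h2] at h1
    have h3 : (2 : ℝ) ≤ 0 := ge_of_tendsto h1 <| by
      filter_upwards [eventually_ge_atTop 0] with t ht using hE t ht
    norm_num at h3
  have h1 : k * Real.pi ≤ (1 : ℤ) * Real.pi := le_of_tendsto hk <| by
    filter_upwards [eventually_ge_atTop 0] with t ht using by simpa using (hlt t ht).le
  have h2 : (-1 : ℤ) * Real.pi ≤ k * Real.pi := ge_of_tendsto hk <| by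
    filter_upwards [eventually_ge_atTop 0] with t ht using (hgt t ht).le
  have h1' : k ≤ 1 := by exact_mod_cast le_of_mul_le_mul_right h1 Real.pi_pos
  have h2' : -1 ≤ k := by exact_mod_cast le_of_mul_le_mul_right h2 Real.pi_pos
  have h3 : k ≠ -1 := by
    rintro rfl
    exact h.not_tendsto_of_le ha hb hodd hx (fun t ht => (hgt t ht).le) hk
  have h4 : k = 1 := by
    obtain ⟨m, rfl⟩ := hodd
    omega
  exact ⟨h, by simpa [h4] using hk, eventually_atTop.2 ⟨0, hx⟩⟩

/-- In the bound, 1 pays for the drift of x over unit time and b for the term b sin θ; what is left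
makes θ' at least π - θ(0). -/
theorem pi_le_of_snd_le (ha : 0 < a) (hb : 0 < b) (h : IsOrbit a b θ x)
    (hx : x 0 ≤ -(1 + b + (Real.pi - θ 0) / a)) : Real.pi ≤ θ 1 := by
  have h1 : ∀ t ∈ Icc (0 : ℝ) 1, x t ≤ x 0 + 1 := fun t ht => by
    have := (convex_Icc (0 : ℝ) 1).norm_image_sub_le_of_norm_hasDerivWithin_le (C := 1)
      (fun u _ => (h.hasDerivAt_snd u).hasDerivWithinAt) (fun u _ => Real.abs_sin_le_one _)
      (left_mem_Icc.2 zero_le_one) ht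
    rw [Real.norm_eq_abs, Real.norm_eq_abs, sub_zero, abs_of_nonneg ht.1] at this
    linarith [(abs_le.1 this).2, ht.2]
  have h2 : MonotoneOn (fun t => θ t - (Real.pi - θ 0) * t) (Icc 0 1) := by
    refine monotoneOn_of_hasDerivWithinAt_nonneg (convex_Icc 0 1)
      (h.continuous_fst.sub (continuous_const.mul continuous_id)).continuousOn
      (fun t _ => ((h.hasDerivAt_fst t).sub
        ((hasDerivAt_id t).const_mul (Real.pi - θ 0))).hasDerivWithinAt) fun t ht => ?_
    have h3 := h1 t (interior_subset ht)
    have h4 : b * Real.sin (θ t) ≤ b := mul_le_of_le_one_right hb.le (Real.sin_le_one _)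
    have h5 : a * (x t + b * Real.sin (θ t)) ≤ a * (-((Real.pi - θ 0) / a)) := by
      gcongr
      linarith
    have h6 : a * (-((Real.pi - θ 0) / a)) = -(Real.pi - θ 0) := by field_simp
    linarith
  have := h2 (left_mem_Icc.2 zero_le_one) (right_mem_Icc.2 zero_le_one) zero_le_one
  simp only [mul_zero, sub_zero, mul_one] at this
  linarith

end IsOrbit

/-! ### Existence of the separatrix by connectedness. -/

/-- The negative initial values `x₀` above `θ₀` whose orbits overshoot the saddle `(π, 0)`. -/
def overshootSlice (a b θ₀ : ℝ) : Set ℝ :=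
  {x₀ | x₀ < 0 ∧ ∃ t, 0 ≤ t ∧ 2 < energy a (flow a b (θ₀, x₀) t) ∧
    Real.pi < (flow a b (θ₀, x₀) t).1}

/-- The negative initial values `x₀` above `θ₀` whose orbits are captured left of the saddle
`(π, 0)`. -/
def captureSlice (a b θ₀ : ℝ) : Set ℝ :=
  {x₀ | x₀ < 0 ∧ ∃ t, 0 ≤ t ∧ energy a (flow a b (θ₀, x₀) t) < 2 ∧
    (flow a b (θ₀, x₀) t).1 < Real.pi}

section Slices

variable {a b θ₀ x₀ : ℝ}

theorem isOpen_overshootSlice : IsOpen (overshootSlice a b θ₀) := by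
  have : overshootSlice a b θ₀ = Iio 0 ∩ ⋃ t : ℝ, ⋃ _ : 0 ≤ t,
      {x₀ | 2 < energy a (flow a b (θ₀, x₀) t) ∧ Real.pi < (flow a b (θ₀, x₀) t).1} := by
    ext
    simp only [overshootSlice, mem_inter_iff, mem_iUnion, mem_ofPred_eq, mem_Iio, exists_prop]
  rw [this]
  refine isOpen_Iio.inter (isOpen_iUnion fun t => isOpen_iUnion fun ht => ?_)
  have hc : Continuous fun x₀ => flow a b (θ₀, x₀) t :=
    (flow_continuous a b ht).comp (continuous_const.prodMk continuous_id)
  exact (isOpen_lt continuous_const ((energy_continuous a).comp hc)).inter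
    (isOpen_lt continuous_const (continuous_fst.comp hc))

theorem isOpen_captureSlice : IsOpen (captureSlice a b θ₀) := by
  have : captureSlice a b θ₀ = Iio 0 ∩ ⋃ t : ℝ, ⋃ _ : 0 ≤ t,
      {x₀ | energy a (flow a b (θ₀, x₀) t) < 2 ∧ (flow a b (θ₀, x₀) t).1 < Real.pi} := by
    ext
    simp only [captureSlice, mem_inter_iff, mem_iUnion, mem_ofPred_eq, mem_Iio, exists_prop]
  rw [this]
  refine isOpen_Iio.inter (isOpen_iUnion fun t => isOpen_iUnion fun ht => ?_)
  have hc : Continuous fun x₀ => flow a b (θ₀, x₀) t :=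
    (flow_continuous a b ht).comp (continuous_const.prodMk continuous_id)
  exact (isOpen_lt ((energy_continuous a).comp hc) continuous_const).inter
    (isOpen_lt (continuous_fst.comp hc) continuous_const)

theorem one_lt_of_mem_overshootSlice (ha : 0 < a) (hb : 0 < b) (hx : x₀ ∈ overshootSlice a b θ₀)
    {k : ℤ} (hk : Tendsto (fun t => (flow a b (θ₀, x₀) t).1) atTop (𝓝 (k * Real.pi))) : 1 < k := by
  obtain ⟨h0, t, ht, -, hlt⟩ := hx
  exact (flow_isOrbit a b (θ₀, x₀)).one_lt_of_tendsto ha hb (by simpa [flow_zero] using h0) ht hlt hk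

theorem tendsto_of_mem_captureSlice (ha : 0 < a) (hb : 0 < b) (hθ : -Real.pi < θ₀)
    (hx : x₀ ∈ captureSlice a b θ₀) :
    Tendsto (fun t => (flow a b (θ₀, x₀) t).1) atTop (𝓝 0) := by
  obtain ⟨h0, t, ht, hE, hlt⟩ := hx
  exact (flow_isOrbit a b (θ₀, x₀)).tendsto_zero_of_neg ha hb (by simpa [flow_zero] using h0)
    (by simpa [flow_zero] using hθ) ht hE hlt

theorem disjoint_slices (ha : 0 < a) (hb : 0 < b) (hθ : -Real.pi < θ₀) :
    Disjoint (overshootSlice a b θ₀) (captureSlice a b θ₀) :=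
  Set.disjoint_left.2 fun x₀ h1 h2 => by
    have := one_lt_of_mem_overshootSlice ha hb h1 (k := 0)
      (by simpa using tendsto_of_mem_captureSlice ha hb hθ h2)
    omega

theorem isSeparatrixOrbit_flow (ha : 0 < a) (hb : 0 < b) (hθ : θ₀ ∈ Ioo (-Real.pi) Real.pi)
    (h0 : x₀ < 0) (h1 : x₀ ∉ overshootSlice a b θ₀) (h2 : x₀ ∉ captureSlice a b θ₀) :
    IsSeparatrixOrbit a b (fun t => (flow a b (θ₀, x₀) t).1)
      (fun t => (flow a b (θ₀, x₀) t).2) := by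
  have h := flow_isOrbit a b (θ₀, x₀)
  have hlt : ∀ t, 0 ≤ t → (flow a b (θ₀, x₀) t).1 < Real.pi := fun t ht => by
    by_contra! hge
    have := h.exists_pi_lt ha hb (by simpa [flow_zero] using h0)
      (by simpa [flow_zero] using hθ.2) ht hge
    exact h1 ⟨h0, this⟩
  refine h.isSeparatrixOrbit ha hb (by simpa [flow_zero] using h0)
    (by simpa [flow_zero] using hθ.1) hlt fun t ht => ?_
  by_contra! hE
  exact h2 ⟨h0, t, ht, hE, hlt t ht⟩

theorem exists_lt_mem_overshootSlice (ha : 0 < a) (hb : 0 < b) (hθ : θ₀ < Real.pi) (c : ℝ) :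
    ∃ x₀ < c, x₀ ∈ overshootSlice a b θ₀ := by
  have hpos : 0 < (Real.pi - θ₀) / a := div_pos (by linarith) ha
  set y := min (c - 1) (-(1 + b + (Real.pi - θ₀) / a))
  have hy1 : y ≤ c - 1 := min_le_left _ _
  have hy2 : y ≤ -(1 + b + (Real.pi - θ₀) / a) := min_le_right _ _
  have h := flow_isOrbit a b (θ₀, y)
  have hy : y < 0 := by linarith
  have h1 := h.pi_le_of_snd_le ha hb (by simp only [flow_zero]; exact hy2)
  have := h.exists_pi_lt ha hb (by simpa [flow_zero] using hy)
    (by simpa [flow_zero] using hθ) zero_le_one h1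
  exact ⟨y, by linarith, hy, this⟩

theorem exists_gt_mem_captureSlice (hθ : θ₀ ∈ Ioo (-Real.pi) Real.pi) {c : ℝ} (hc : c < 0) :
    ∃ x₀ > c, x₀ ∈ captureSlice a b θ₀ := by
  have hcos : -1 < Real.cos θ₀ := by
    rw [← Real.cos_abs, ← Real.cos_pi]
    exact Real.cos_lt_cos_of_nonneg_of_le_pi (abs_nonneg _) le_rfl (abs_lt.2 hθ)
  have h1 : ∀ᶠ y in 𝓝 (0 : ℝ), energy a (θ₀, y) < 2 := by
    refine ((energy_continuous a).comp (continuous_const.prodMk continuous_id)).continuousAt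
      |>.eventually (gt_mem_nhds ?_)
    simp [energy]
    linarith
  obtain ⟨y, hy, hyc, hy0⟩ := ((h1.filter_mono nhdsWithin_le_nhds).and
    (((lt_mem_nhds hc).filter_mono nhdsWithin_le_nhds).and
      (self_mem_nhdsWithin (a := (0 : ℝ)) (s := Iio 0)))).exists
  exact ⟨y, hyc, hy0, 0, le_rfl, by simpa [flow_zero] using hy, by simpa [flow_zero] using hθ.2⟩

/-- The lower separatrix has a point above every `θ₀ ∈ (-π, π)`; below it orbits overshoot the
saddle, above it they are captured. -/
theorem exists_separatrix (ha : 0 < a) (hb : 0 < b) (hθ : θ₀ ∈ Ioo (-Real.pi) Real.pi) :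
    ∃ y < 0, IsSeparatrixOrbit a b (fun t => (flow a b (θ₀, y) t).1)
        (fun t => (flow a b (θ₀, y) t).2) ∧
      Iio y ⊆ overshootSlice a b θ₀ ∧ Ioo y 0 ⊆ captureSlice a b θ₀ := by
  have hdisj := disjoint_slices (b := b) ha hb hθ.1
  obtain ⟨y, hy0, hyA, hyB⟩ : ∃ y < 0, y ∉ overshootSlice a b θ₀ ∧ y ∉ captureSlice a b θ₀ := by
    -- Two disjoint nonempty open sets cannot cover the half-line x < 0.
    by_contra! hcon
    obtain ⟨p, hp0, hp⟩ := exists_lt_mem_overshootSlice ha hb hθ.2 0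
    obtain ⟨q, hq0, hq⟩ := exists_gt_mem_captureSlice (a := a) (b := b) hθ (c := -1) (by norm_num)
    obtain ⟨r, -, hr1, hr2⟩ := isPreconnected_Iio (a := (0 : ℝ)) _ _ isOpen_overshootSlice
      isOpen_captureSlice (fun y hy => or_iff_not_imp_left.2 (hcon y hy)) ⟨p, hp0, hp⟩
      ⟨q, hq.1, hq⟩
    exact Set.disjoint_left.1 hdisj hr1 hr2
  have hsep := isSeparatrixOrbit_flow ha hb hθ hy0 hyA hyB
  -- By uniqueness all other heights overshoot or are captured; connectedness of each side of y
  -- leaves one outcome per side.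
  have huniq : ∀ z < 0, z ≠ y → z ∈ overshootSlice a b θ₀ ∪ captureSlice a b θ₀ := by
    intro z hz hne
    by_contra hz'
    rw [mem_union, not_or] at hz'
    have hsep' := isSeparatrixOrbit_flow ha hb hθ hz hz'.1 hz'.2
    have h1 := hsep.snd_unique ha hb hsep' (by simp [flow_zero])
    have h2 := hsep'.snd_unique ha hb hsep (by simp [flow_zero])
    simp only [flow_zero] at h1 h2
    exact hne (le_antisymm h1 h2)
  refine ⟨y, hy0, hsep, ?_, ?_⟩
  · obtain ⟨p, hp0, hp⟩ := exists_lt_mem_overshootSlice ha hb hθ.2 y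
    exact isPreconnected_Iio.subset_left_of_subset_union isOpen_overshootSlice isOpen_captureSlice
      hdisj (fun z hz => huniq z (lt_trans hz hy0) (ne_of_lt hz)) ⟨p, hp0, hp⟩
  · obtain ⟨q, hq0, hq⟩ := exists_gt_mem_captureSlice (a := a) (b := b) hθ hy0
    exact isPreconnected_Ioo.subset_right_of_subset_union isOpen_overshootSlice isOpen_captureSlice
      hdisj (fun z hz => huniq z hz.2 (ne_of_gt hz.1)) ⟨q, ⟨hq0, hq.1⟩, hq⟩

end Slices
-- Return to arbitrary ω: shift, stability, locked states and Q.
variable {K₀ τ₁ τ₂ : ℝ}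

theorem xEq_zero : xEq K₀ τ₁ 0 = 0 := by simp [xEq]

theorem xEq_sub (ω ω' : ℝ) : xEq K₀ τ₁ (ω - ω') = xEq K₀ τ₁ ω - xEq K₀ τ₁ ω' := by
  simp only [xEq]
  ring

theorem field_eq_shift (hK₀ : K₀ ≠ 0) (hτ₁ : τ₁ ≠ 0) (ω : ℝ) (p : ℝ × ℝ) :
    field K₀ τ₁ τ₂ ω p = field K₀ τ₁ τ₂ 0 (p.1, p.2 - xEq K₀ τ₁ ω) := by
  simp only [field, xEq, Prod.mk.injEq, and_true]
  field_simp
  ring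

theorem isSolutionOn_iff_shift (hK₀ : K₀ ≠ 0) (hτ₁ : τ₁ ≠ 0) (ω : ℝ) (s : Set ℝ)
    (γ : ℝ → ℝ × ℝ) : IsSolutionOn K₀ τ₁ τ₂ ω γ s ↔
      IsSolutionOn K₀ τ₁ τ₂ 0 (fun t => ((γ t).1, (γ t).2 - xEq K₀ τ₁ ω)) s := by
  have h : (fun t => ((γ t).1, (γ t).2 - xEq K₀ τ₁ ω)) = fun t => γ t - (0, xEq K₀ τ₁ ω) := by
    ext t <;> simp
  refine forall₂_congr fun t _ => ?_
  beta_reduce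
  rw [h, hasDerivWithinAt_sub_const_iff, field_eq_shift hK₀ hτ₁]

theorem isSolutionOn_add (hK₀ : K₀ ≠ 0) (hτ₁ : τ₁ ≠ 0) (ω : ℝ) {θ x : ℝ → ℝ}
    (h : IsOrbit (K₀ / τ₁) τ₂ θ x) :
    IsSolutionOn K₀ τ₁ τ₂ ω (fun t => (θ t, x t + xEq K₀ τ₁ ω)) (Ici 0) := by
  rw [isSolutionOn_iff_shift hK₀ hτ₁]
  simpa using h.isSolutionOn (Ici 0)

/-- Up to the vertical shift, the solutions on `[0, ∞)` are the restrictions of the orbits. -/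
theorem IsSolutionOn.exists_isOrbit_add (hK₀ : K₀ ≠ 0) (hτ₁ : τ₁ ≠ 0) {ω : ℝ} {γ : ℝ → ℝ × ℝ}
    (hγ : IsSolutionOn K₀ τ₁ τ₂ ω γ (Ici 0)) : ∃ θ x, IsOrbit (K₀ / τ₁) τ₂ θ x ∧
      ∀ t, 0 ≤ t → γ t = (θ t, x t + xEq K₀ τ₁ ω) := by
  obtain ⟨θ, x, h, heq⟩ := ((isSolutionOn_iff_shift hK₀ hτ₁ ω _ _).1 hγ).exists_isOrbit
  refine ⟨θ, x, h, fun t ht => ?_⟩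
  have := heq t ht
  rw [Prod.mk.injEq] at this
  rw [← this.1, ← this.2, sub_add_cancel]

theorem isEquilibrium_int_mul_pi (hK₀ : K₀ ≠ 0) (hτ₁ : τ₁ ≠ 0) (ω : ℝ) (k : ℤ) :
    IsEquilibrium K₀ τ₁ τ₂ ω (k * Real.pi, xEq K₀ τ₁ ω) := by
  rw [IsEquilibrium, field_eq_shift hK₀ hτ₁]
  simp [field, Real.sin_int_mul_pi]

theorem isGloballyAsymptoticallyStable (hK₀ : 0 < K₀) (hτ₁ : 0 < τ₁) (hτ₂ : 0 < τ₂) (ω : ℝ) :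
    IsGloballyAsymptoticallyStable K₀ τ₁ τ₂ ω := by
  intro γ hγ
  obtain ⟨θ, x, h, heq⟩ := hγ.exists_isOrbit_add hK₀.ne' hτ₁.ne'
  have ha := div_pos hK₀ hτ₁
  obtain ⟨k, hk⟩ := h.tendsto_fst ha hτ₂
  refine ⟨_, isEquilibrium_int_mul_pi hK₀.ne' hτ₁.ne' ω k, ?_⟩
  have h1 := hk.prodMk_nhds ((h.tendsto_snd ha hτ₂).add_const (xEq K₀ τ₁ ω))
  rw [zero_add] at h1
  refine h1.congr' ?_
  filter_upwards [eventually_ge_atTop 0] with t ht using (heq t ht).symm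

/-- The sublevel sets of the energy between two saddles shrink to the equilibrium `(0, 0)`. -/
theorem exists_energy_lt_imp_mem {a : ℝ} (ha : 0 < a) {U : Set (ℝ × ℝ)} (hU : U ∈ 𝓝 (0, 0)) :
    ∃ ε > 0, ∀ p : ℝ × ℝ, |p.1| < Real.pi → energy a p < ε → p ∈ U := by
  obtain ⟨δ, hδ, hball⟩ := Metric.mem_nhds_iff.1 hU
  have hpi := Real.pi_pos
  -- The factor 2/π² comes from cos θ ≤ 1 - (2/π²) θ² for |θ| ≤ π.
  refine ⟨min (a * δ ^ 2 / 2) (2 / Real.pi ^ 2 * δ ^ 2), by positivity, fun p hp hE => hball ?_⟩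
  have h1 := hE.trans_le (min_le_left _ _)
  have h2 := hE.trans_le (min_le_right _ _)
  have h3 := Real.cos_le_one_sub_mul_cos_sq hp.le
  have h4 := Real.cos_le_one p.1
  have h5 : 0 ≤ a * p.2 ^ 2 / 2 := by positivity
  simp only [energy] at h1 h2
  have h6 : 2 / Real.pi ^ 2 * p.1 ^ 2 < 2 / Real.pi ^ 2 * δ ^ 2 := by linarith
  have h7 : p.1 ^ 2 < δ ^ 2 := lt_of_mul_lt_mul_left h6 (by positivity)
  have h8 : p.2 ^ 2 < δ ^ 2 := lt_of_mul_lt_mul_left (by linarith) ha.le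
  rw [Metric.mem_ball, Prod.dist_eq, Real.dist_eq, Real.dist_eq, sub_zero, sub_zero]
  exact max_lt (abs_lt_of_sq_lt_sq h7 hδ.le) (abs_lt_of_sq_lt_sq h8 hδ.le)

theorem isLockedState_xEq (hK₀ : 0 < K₀) (hτ₁ : 0 < τ₁) (hτ₂ : 0 < τ₂) (ω : ℝ) :
    IsLockedState K₀ τ₁ τ₂ ω (0, xEq K₀ τ₁ ω) := by
  have ha := div_pos hK₀ hτ₁
  have hpi := Real.pi_pos
  have hV : ∀ ε > 0, {p : ℝ × ℝ | |p.1| < Real.pi ∧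
      energy (K₀ / τ₁) (p.1, p.2 - xEq K₀ τ₁ ω) < ε} ∈ 𝓝 ((0 : ℝ), xEq K₀ τ₁ ω) := fun ε hε => by
    have h1 : IsOpen {p : ℝ × ℝ | |p.1| < Real.pi} :=
      isOpen_lt continuous_fst.abs continuous_const
    have h2 : Continuous fun p : ℝ × ℝ => energy (K₀ / τ₁) (p.1, p.2 - xEq K₀ τ₁ ω) :=
      (energy_continuous _).comp (by fun_prop)
    refine (h1.inter (isOpen_lt h2 continuous_const)).mem_nhds ⟨?_, ?_⟩
    · simpa using hpi
    · simpa [energy] using hε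
  refine ⟨by simpa using isEquilibrium_int_mul_pi hK₀.ne' hτ₁.ne' ω 0, fun U hU => ?_, ?_⟩
  · have hU' : (fun p : ℝ × ℝ => (p.1, p.2 + xEq K₀ τ₁ ω)) ⁻¹' U ∈ 𝓝 ((0 : ℝ), (0 : ℝ)) :=
      (show Continuous fun p : ℝ × ℝ => (p.1, p.2 + xEq K₀ τ₁ ω) by fun_prop).continuousAt
        (by simpa using hU)
    obtain ⟨ε, hε, hεU⟩ := exists_energy_lt_imp_mem ha hU'
    -- The 2 confines the orbit to the strip |θ| < π, the ε to U.
    refine ⟨_, hV (min ε 2) (by positivity), fun γ hγ h0 t ht => ?_⟩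
    obtain ⟨θ, x, h, heq⟩ := hγ.exists_isOrbit_add hK₀.ne' hτ₁.ne'
    rw [heq 0 le_rfl] at h0
    simp only [mem_ofPred_eq, add_sub_cancel_right] at h0
    rw [heq t ht]
    exact hεU (θ t, x t)
      (h.abs_fst_lt_pi ha hτ₂ (h0.2.trans_le (min_le_right _ _)) h0.1 ht)
      ((h.energy_antitone ha hτ₂ ht).trans_lt (h0.2.trans_le (min_le_left _ _)))
  · refine ⟨_, hV 2 two_pos, fun γ hγ h0 => ?_⟩
    obtain ⟨θ, x, h, heq⟩ := hγ.exists_isOrbit_add hK₀.ne' hτ₁.ne'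
    rw [heq 0 le_rfl] at h0
    simp only [mem_ofPred_eq, add_sub_cancel_right] at h0
    have h1 := (h.tendsto_zero_of_energy_lt ha hτ₂ h0.2 h0.1).prodMk_nhds
      ((h.tendsto_snd ha hτ₂).add_const (xEq K₀ τ₁ ω))
    rw [zero_add] at h1
    refine h1.congr' ?_
    filter_upwards [eventually_ge_atTop 0] with t ht using (heq t ht).symm

/-- For a convergent phase the limsup is a limit. -/
theorem cycleSlips_iff {γ : ℝ → ℝ × ℝ} {l : ℝ} (h : Tendsto (fun t => (γ t).1) atTop (𝓝 l)) :
    CycleSlips γ ↔ 2 * Real.pi ≤ |(γ 0).1 - l| := by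
  have h1 : Tendsto (fun t => ((|(γ 0).1 - (γ t).1| : ℝ) : EReal)) atTop
      (𝓝 ((|(γ 0).1 - l| : ℝ) : EReal)) :=
    (continuous_coe_real_ereal.tendsto _).comp (h.const_sub _).abs
  rw [CycleSlips, h1.limsup_eq, EReal.coe_le_coe_iff]

theorem mem_lowerSeparatrix_shift (hK₀ : K₀ ≠ 0) (hτ₁ : τ₁ ≠ 0) (ω θ₀ x₀ : ℝ) :
    (θ₀, x₀) ∈ lowerSeparatrix K₀ τ₁ τ₂ ω ↔
      (θ₀, x₀ - xEq K₀ τ₁ ω) ∈ lowerSeparatrix K₀ τ₁ τ₂ 0 := by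
  constructor
  · rintro ⟨γ, hγ, h0, hlim, hneg⟩
    refine ⟨_, (isSolutionOn_iff_shift hK₀ hτ₁ ω _ _).1 hγ, by simp [h0], ?_, ?_⟩
    · have := ((continuous_fst.tendsto _).comp hlim).prodMk_nhds
        (((continuous_snd.tendsto _).comp hlim).sub_const (xEq K₀ τ₁ ω))
      simpa [xEq_zero] using this
    · filter_upwards [hneg] with t ht
      simpa [xEq_zero] using ht
  · rintro ⟨γ, hγ, h0, hlim, hneg⟩
    refine ⟨fun t => ((γ t).1, (γ t).2 + xEq K₀ τ₁ ω),
      (isSolutionOn_iff_shift hK₀ hτ₁ ω _ _).2 (by simpa using hγ), by simp [h0], ?_, ?_⟩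
    · have := ((continuous_fst.tendsto _).comp hlim).prodMk_nhds
        (((continuous_snd.tendsto _).comp hlim).add_const (xEq K₀ τ₁ ω))
      simpa [xEq_zero] using this
    · filter_upwards [hneg] with t ht
      simpa [xEq_zero] using ht

theorem mem_lowerSeparatrix_zero_iff (hK₀ : 0 < K₀) (hτ₁ : 0 < τ₁) (hτ₂ : 0 < τ₂) {θ₀ x₀ : ℝ} :
    (θ₀, x₀) ∈ lowerSeparatrix K₀ τ₁ τ₂ 0 ↔
      ∃ θ x, IsSeparatrixOrbit (K₀ / τ₁) τ₂ θ x ∧ θ 0 = θ₀ ∧ x 0 = x₀ := by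
  constructor
  · rintro ⟨γ, hγ, h0, hlim, hneg⟩
    obtain ⟨θ, x, h, heq⟩ := hγ.exists_isOrbit
    rw [heq 0 le_rfl, Prod.mk.injEq] at h0
    refine ⟨θ, x, ⟨h, ?_, ?_⟩, h0⟩
    · refine ((continuous_fst.tendsto _).comp hlim).congr' ?_
      filter_upwards [eventually_ge_atTop 0] with t ht
      simp [heq t ht]
    · filter_upwards [hneg, eventually_ge_atTop 0] with t h1 ht
      simpa [heq t ht, xEq_zero] using h1
  · rintro ⟨θ, x, h, rfl, rfl⟩
    refine ⟨_, h.toIsOrbit.isSolutionOn _, rfl, ?_, ?_⟩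
    · rw [xEq_zero]
      exact h.tendsto_pi.prodMk_nhds (h.toIsOrbit.tendsto_snd (div_pos hK₀ hτ₁) hτ₂)
    · simpa only [xEq_zero] using h.eventually_neg

theorem exists_mem_lowerSeparatrix_iff (hK₀ : 0 < K₀) (hτ₁ : 0 < τ₁) (hτ₂ : 0 < τ₂) {θ₀ : ℝ}
    (hθ : θ₀ ∈ Ioo (-Real.pi) Real.pi) :
    ∃ y < 0, (∀ x₀, (θ₀, x₀) ∈ lowerSeparatrix K₀ τ₁ τ₂ 0 ↔ x₀ = y) ∧
      Iio y ⊆ overshootSlice (K₀ / τ₁) τ₂ θ₀ ∧ Ioo y 0 ⊆ captureSlice (K₀ / τ₁) τ₂ θ₀ := by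
  have ha := div_pos hK₀ hτ₁
  obtain ⟨y, hy, hsep, h1, h2⟩ := exists_separatrix ha hτ₂ hθ
  refine ⟨y, hy, fun x₀ => ?_, h1, h2⟩
  rw [mem_lowerSeparatrix_zero_iff hK₀ hτ₁ hτ₂]
  constructor
  · rintro ⟨θ, x, h, h0, rfl⟩
    have e1 := hsep.snd_unique ha hτ₂ h (by simp [flow_zero, h0])
    have e2 := h.snd_unique ha hτ₂ hsep (by simp [flow_zero, h0])
    simp only [flow_zero] at e1 e2
    exact le_antisymm e1 e2
  · rintro rfl
    exact ⟨_, _, hsep, by simp [flow_zero], by simp [flow_zero]⟩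

theorem mem_lowerSeparatrix_zero_iff_eq_Q (hK₀ : 0 < K₀) (hτ₁ : 0 < τ₁) (hτ₂ : 0 < τ₂) {θ₀ x₀ : ℝ}
    (hθ : θ₀ ∈ Ioo (-Real.pi) Real.pi) :
    (θ₀, x₀) ∈ lowerSeparatrix K₀ τ₁ τ₂ 0 ↔ x₀ = Q K₀ τ₁ τ₂ θ₀ 0 := by
  obtain ⟨y, -, hy, -⟩ := exists_mem_lowerSeparatrix_iff hK₀ hτ₁ hτ₂ hθ
  have hQ : (θ₀, Q K₀ τ₁ τ₂ θ₀ 0) ∈ lowerSeparatrix K₀ τ₁ τ₂ 0 :=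
    Classical.epsilon_spec (p := fun x => (θ₀, x) ∈ lowerSeparatrix K₀ τ₁ τ₂ 0) ⟨y, (hy y).2 rfl⟩
  rw [hy, (hy _).1 hQ]

theorem Q_eq_add (hK₀ : 0 < K₀) (hτ₁ : 0 < τ₁) (hτ₂ : 0 < τ₂) {θ₀ : ℝ}
    (hθ : θ₀ ∈ Ioo (-Real.pi) Real.pi) (ω : ℝ) :
    Q K₀ τ₁ τ₂ θ₀ ω = xEq K₀ τ₁ ω + Q K₀ τ₁ τ₂ θ₀ 0 := by
  have hiff : ∀ x, (θ₀, x) ∈ lowerSeparatrix K₀ τ₁ τ₂ ω ↔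
      x - xEq K₀ τ₁ ω = Q K₀ τ₁ τ₂ θ₀ 0 := fun x => by
    rw [mem_lowerSeparatrix_shift hK₀.ne' hτ₁.ne', mem_lowerSeparatrix_zero_iff_eq_Q hK₀ hτ₁ hτ₂ hθ]
  have := (hiff _).1 (Classical.epsilon_spec (p := fun x => (θ₀, x) ∈ lowerSeparatrix K₀ τ₁ τ₂ ω)
    ⟨xEq K₀ τ₁ ω + Q K₀ τ₁ τ₂ θ₀ 0, (hiff _).2 (by ring)⟩)
  rw [← this, Q]
  ring

theorem mem_lowerSeparatrix_iff_eq_Q (hK₀ : 0 < K₀) (hτ₁ : 0 < τ₁) (hτ₂ : 0 < τ₂) {θ₀ : ℝ}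
    (hθ : θ₀ ∈ Ioo (-Real.pi) Real.pi) (ω x₀ : ℝ) :
    (θ₀, x₀) ∈ lowerSeparatrix K₀ τ₁ τ₂ ω ↔ x₀ = Q K₀ τ₁ τ₂ θ₀ ω := by
  rw [mem_lowerSeparatrix_shift hK₀.ne' hτ₁.ne', mem_lowerSeparatrix_zero_iff_eq_Q hK₀ hτ₁ hτ₂ hθ,
    Q_eq_add hK₀ hτ₁ hτ₂ hθ ω, sub_eq_iff_eq_add']

theorem zero_mem_Ioo_pi : (0 : ℝ) ∈ Ioo (-Real.pi) Real.pi :=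
  ⟨neg_neg_iff_pos.2 Real.pi_pos, Real.pi_pos⟩

theorem exists_separatrix_Q (hK₀ : 0 < K₀) (hτ₁ : 0 < τ₁) (hτ₂ : 0 < τ₂) :
    Q K₀ τ₁ τ₂ 0 0 < 0 ∧ Iio (Q K₀ τ₁ τ₂ 0 0) ⊆ overshootSlice (K₀ / τ₁) τ₂ 0 ∧
      Ioo (Q K₀ τ₁ τ₂ 0 0) 0 ⊆ captureSlice (K₀ / τ₁) τ₂ 0 := by
  obtain ⟨y, hy0, hy, h⟩ := exists_mem_lowerSeparatrix_iff hK₀ hτ₁ hτ₂ zero_mem_Ioo_pi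
  rw [← (mem_lowerSeparatrix_zero_iff_eq_Q hK₀ hτ₁ hτ₂ zero_mem_Ioo_pi).1 ((hy y).2 rfl)]
  exact ⟨hy0, h⟩

/-! ### Lock-in domains and the lock-in frequency. -/

/-- An orbit starting above `θ = 0` closer to the locked state than the separatrix tends to it. -/
theorem IsOrbit.tendsto_zero_of_abs_lt (hK₀ : 0 < K₀) (hτ₁ : 0 < τ₁) (hτ₂ : 0 < τ₂)
    {θ x : ℝ → ℝ} (h : IsOrbit (K₀ / τ₁) τ₂ θ x) (hθ : θ 0 = 0)
    (hx : |x 0| < -Q K₀ τ₁ τ₂ 0 0) : Tendsto θ atTop (𝓝 0) := by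
  have ha := div_pos hK₀ hτ₁
  obtain ⟨-, -, hcap⟩ := exists_separatrix_Q hK₀ hτ₁ hτ₂
  have key : ∀ θ x : ℝ → ℝ, IsOrbit (K₀ / τ₁) τ₂ θ x → θ 0 = 0 → |x 0| < -Q K₀ τ₁ τ₂ 0 0 →
      x 0 < 0 → Tendsto θ atTop (𝓝 0) := fun θ x h hθ hx hneg => by
    have := tendsto_of_mem_captureSlice ha hτ₂ zero_mem_Ioo_pi.1
      (hcap ⟨by linarith [(abs_lt.1 hx).1], hneg⟩)
    refine this.congr' ?_
    filter_upwards [eventually_ge_atTop 0] with t ht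
    have := h.eq_flow ht
    rw [hθ] at this
    rw [← this]
  rcases lt_trichotomy (x 0) 0 with h0 | h0 | h0
  · exact key θ x h hθ hx h0
  · refine (tendsto_const_nhds (x := (0 : ℝ))).congr fun t => ?_
    rw [(h.eq_of_isEquilibrium (s := 0) (by simp [hθ]) h0 t).1, hθ]
  · have := key _ _ h.comp_neg (by simp [hθ]) (by simpa using hx) (by simpa using h0)
    simpa using this.neg

theorem mem_lockInDomain (hK₀ : 0 < K₀) (hτ₁ : 0 < τ₁) (hτ₂ : 0 < τ₂) {ω ω' : ℝ}
    (h : |xEq K₀ τ₁ (ω - ω')| < -Q K₀ τ₁ τ₂ 0 0) :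
    (0, xEq K₀ τ₁ ω) ∈ lockInDomain K₀ τ₁ τ₂ ω' := by
  have ha := div_pos hK₀ hτ₁
  obtain ⟨θ, x, ho, hθ, hx⟩ := exists_isOrbit (K₀ / τ₁) τ₂ 0 (xEq K₀ τ₁ (ω - ω'))
  have hlim := ho.tendsto_zero_of_abs_lt hK₀ hτ₁ hτ₂ hθ (by rwa [hx])
  refine ⟨_, isSolutionOn_add hK₀.ne' hτ₁.ne' ω' ho, ?_,
    ⟨_, isLockedState_xEq hK₀ hτ₁ hτ₂ ω', ?_⟩, ?_⟩
  · simp [hθ, hx, xEq_sub]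
  · have := hlim.prodMk_nhds ((ho.tendsto_snd ha hτ₂).add_const (xEq K₀ τ₁ ω'))
    rwa [zero_add] at this
  · rw [cycleSlips_iff (l := 0) hlim]
    simp [hθ, Real.pi_pos]

/-- Below the separatrix the phase goes from 0 to some kπ with k ≥ 2, which is a cycle slip. -/
theorem notMem_lockInDomain (hK₀ : 0 < K₀) (hτ₁ : 0 < τ₁) (hτ₂ : 0 < τ₂) {ω ω' : ℝ}
    (h : xEq K₀ τ₁ (ω - ω') < Q K₀ τ₁ τ₂ 0 0) :
    (0, xEq K₀ τ₁ ω) ∉ lockInDomain K₀ τ₁ τ₂ ω' := by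
  have ha := div_pos hK₀ hτ₁
  rintro ⟨γ, hγ, h0, -, hslip⟩
  obtain ⟨θ, x, ho, heq⟩ := hγ.exists_isOrbit_add hK₀.ne' hτ₁.ne'
  have hθ0 : θ 0 = 0 := by simpa [heq 0 le_rfl] using congrArg Prod.fst h0
  have hx0 : x 0 = xEq K₀ τ₁ (ω - ω') := by
    have : x 0 + xEq K₀ τ₁ ω' = xEq K₀ τ₁ ω := by
      simpa [heq 0 le_rfl] using congrArg Prod.snd h0
    rw [xEq_sub, ← this, add_sub_cancel_right]
  obtain ⟨k, hk⟩ := ho.tendsto_fst ha hτ₂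
  have hk1 : 1 < k := by
    refine one_lt_of_mem_overshootSlice ha hτ₂ ((exists_separatrix_Q hK₀ hτ₁ hτ₂).2.1 h)
      (hk.congr' ?_)
    filter_upwards [eventually_ge_atTop 0] with t ht
    have := ho.eq_flow ht
    rw [hθ0, hx0] at this
    rw [← this]
  refine hslip ((cycleSlips_iff (l := k * Real.pi) (hk.congr' ?_)).2 ?_)
  · filter_upwards [eventually_ge_atTop 0] with t ht
    rw [heq t ht]
  · rw [h0, zero_sub, abs_neg]
    have : (2 : ℝ) ≤ k := by exact_mod_cast hk1
    exact (mul_le_mul_of_nonneg_right this Real.pi_pos.le).trans (le_abs_self _)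

theorem hasLockInProperty_iff (hK₀ : 0 < K₀) (hτ₁ : 0 < τ₁) (hτ₂ : 0 < τ₂) {w : ℝ} :
    HasLockInProperty K₀ τ₁ τ₂ w ↔ w ≤ -(K₀ * Q K₀ τ₁ τ₂ 0 0) / (2 * τ₁) := by
  have hQ := (exists_separatrix_Q hK₀ hτ₁ hτ₂).1
  constructor
  · rintro ⟨-, h⟩
    by_contra! hlt
    set w₀ := -(K₀ * Q K₀ τ₁ τ₂ 0 0) / (2 * τ₁) with hw₀
    have hw₀pos : 0 < w₀ := div_pos (by nlinarith) (by positivity)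
    -- The pair ω, -ω has difference -(w₀ + w), beyond the critical -2w₀, while |ω| is the midpoint
    -- of w₀ and w.
    set ω := -((w₀ + w) / 2) with hω
    have h1 : |ω| < w := by rw [hω, abs_neg, abs_of_pos (by linarith)]; linarith
    have h2 : |-ω| < w := by rwa [abs_neg]
    have h3 := mem_iInter₂.1 (h ω h1) (-ω) h2
    refine notMem_lockInDomain hK₀ hτ₁ hτ₂ ?_ h3
    have h4 : Q K₀ τ₁ τ₂ 0 0 = -(2 * w₀) * τ₁ / K₀ := by
      rw [hw₀]
      field_simp
    rw [h4, xEq]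
    gcongr
    rw [hω]
    linarith
  · intro hle
    refine ⟨fun ω _ => isGloballyAsymptoticallyStable hK₀ hτ₁ hτ₂ ω, fun ω hω => ?_⟩
    refine mem_iInter₂.2 fun ω' hω' => mem_lockInDomain hK₀ hτ₁ hτ₂ ?_
    have h1 : |ω - ω'| < 2 * w := (abs_sub _ _).trans_lt (by linarith [show |ω'| < w from hω'])
    rw [le_div_iff₀ (by positivity)] at hle
    rw [xEq, abs_div, abs_mul, abs_of_pos hτ₁, abs_of_pos hK₀, div_lt_iff₀ hK₀]
    nlinarith

theorem isLockInFrequency_iff (hK₀ : 0 < K₀) (hτ₁ : 0 < τ₁) (hτ₂ : 0 < τ₂) (w : ℝ) :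
    IsLockInFrequency K₀ τ₁ τ₂ w ↔ w = -(K₀ * Q K₀ τ₁ τ₂ 0 0) / (2 * τ₁) := by
  have hQ := (exists_separatrix_Q hK₀ hτ₁ hτ₂).1
  have hpos : 0 < -(K₀ * Q K₀ τ₁ τ₂ 0 0) / (2 * τ₁) := div_pos (by nlinarith) (by positivity)
  have hgr : IsLockInFrequency K₀ τ₁ τ₂ (-(K₀ * Q K₀ τ₁ τ₂ 0 0) / (2 * τ₁)) :=
    ⟨⟨hpos, (hasLockInProperty_iff hK₀ hτ₁ hτ₂).2 le_rfl⟩,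
      fun v hv => (hasLockInProperty_iff hK₀ hτ₁ hτ₂).1 hv.2⟩
  exact ⟨fun h => h.unique hgr, fun h => h ▸ hgr⟩

end PLL

theorem mainTheorem1 (K₀ τ₁ τ₂ : ℝ) (hK₀ : 0 < K₀) (hτ₁ : 0 < τ₁) (hτ₂ : 0 < τ₂) :
    -- the frequency deviation only shifts the phase plane vertically
    (∀ (ω : ℝ) (s : Set ℝ) (γ : ℝ → ℝ × ℝ),
      PLL.IsSolutionOn K₀ τ₁ τ₂ ω γ s ↔
        PLL.IsSolutionOn K₀ τ₁ τ₂ 0 (fun t => ((γ t).1, (γ t).2 - ω * τ₁ / K₀)) s) ∧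
    -- the lower separatrix is the graph of the function `Q`
    (∀ ω : ℝ, ∀ θ ∈ Set.Ioo (-Real.pi) Real.pi, ∀ x : ℝ,
      (θ, x) ∈ PLL.lowerSeparatrix K₀ τ₁ τ₂ ω ↔ x = PLL.Q K₀ τ₁ τ₂ θ ω) ∧
    -- and it is shifted by the frequency deviation
    (∀ ω : ℝ, ∀ θ ∈ Set.Ioo (-Real.pi) Real.pi,
      PLL.Q K₀ τ₁ τ₂ θ ω = ω * τ₁ / K₀ + PLL.Q K₀ τ₁ τ₂ θ 0) ∧
    -- characterization of the lock-in frequency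
    (∀ ωl : ℝ, PLL.IsLockInFrequency K₀ τ₁ τ₂ ωl ↔
      PLL.xEq K₀ τ₁ (-ωl) = PLL.Q K₀ τ₁ τ₂ 0 ωl) ∧
    -- exact formula: the lock-in frequency exists and has this value
    (∀ ωl : ℝ, PLL.IsLockInFrequency K₀ τ₁ τ₂ ωl ↔
      ωl = -(K₀ * PLL.Q K₀ τ₁ τ₂ 0 0) / (2 * τ₁)) := by
  refine ⟨PLL.isSolutionOn_iff_shift hK₀.ne' hτ₁.ne',
    fun ω θ hθ x => PLL.mem_lowerSeparatrix_iff_eq_Q hK₀ hτ₁ hτ₂ hθ ω x,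
    fun ω θ hθ => PLL.Q_eq_add hK₀ hτ₁ hτ₂ hθ ω, fun ωl => ?_,
    PLL.isLockInFrequency_iff hK₀ hτ₁ hτ₂⟩
  -- By the shift formula the third claim is a linear equation in ωl, with the explicit value as its
  -- only root.
  rw [PLL.isLockInFrequency_iff hK₀ hτ₁ hτ₂, PLL.Q_eq_add hK₀ hτ₁ hτ₂ PLL.zero_mem_Ioo_pi ωl,
    PLL.xEq, PLL.xEq, eq_div_iff (by positivity), neg_mul, neg_div, neg_eq_iff_add_eq_zero]
  field_simp
  constructor <;> intro h <;> linarith
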